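/- Let $(X,\mu)$ be a standard Borel probability space, let $(Y,p)$ be a probability space, and let $\Omega=Y^{\mathbb Z}$, $\mathbb P=p^{\mathbb Z}$, with shift $\theta:\Omega\to\Omega$, $(\theta\omega)_n=\omega_{n+1}$. Put $\bar X=\Omega\times X$ and $\bar\mu=\mathbb P\times\mu$. For $i\in Y$ let $f_i:X\to X$ be maps such that the skew-shift $\bar f(\omega,x)=(\theta\omega,f_{\omega_0}(x))$ is measurable, invertible (modulo null sets, with measurable inverse), preserves $\bar\mu$ and is ergodic. Let $d\ge 1$ and let $A:\bar X\to \mathrm{GL}(d)=\mathrm{GL}(d,\mathbb R)$ be measurable and such that $A(\omega,x)=A_{\omega_0}(x)$ for $\bar\mu$-almost every $(\omega,x)$, where $(i,x)\mapsto A_i(x)\in \mathrm{GL}(d)$ is measurable. Write $A^n(\bar x)=A(\bar f^{\,n-1}(\bar x))\cdots A(\bar f(\bar x))A(\bar x)$. Suppose that $\log^+\|A\|$ and $\log^+\|A^{-1}\|$ are $\bar\mu$-integrable, and let $\lambda_-(A)\le\lambda_+(A)$ be the extremal Lyapunov exponents, that is, the $\bar\mu$-almost everywhere constant values of $$\lambda_-(A)=\lim_{n\to\infty}\frac1n\log\|A^n(\bar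 x)^{-1}\|^{-1},\qquad \lambda_+(A)=\lim_{n\to\infty}\frac1n\log\|A^n(\bar x)\|$$ (these limits exist by the Furstenberg--Kesten theorem). If $\lambda_-(A)=\lambda_+(A)$, then there is a probability measure $\hat\mu$ on $X\times\mathbb P(\mathbb R^d)$ that is $(\bar f,A)$-invariant: $\hat\mu$ projects on $\mu$ under $X\times\mathbb P(\mathbb R^d)\to X$, and for $p$-almost every $i\in Y$ the measure $\hat\mu$ is invariant under the map $F_i(x,z)=(f_i(x),A_i(x)z)$ of $X\times\mathbb P(\mathbb R^d)$. -/

import Mathlib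

open MeasureTheory Filter Topology
open scoped LinearAlgebra.Projectivization

namespace RandomCocycle

/-- The projective space `P(ℝ^d)` of lines through the origin of `ℝ^d`. -/
abbrev ProjSpace (d : ℕ) : Type := ℙ ℝ (Fin d → ℝ)

/-- The quotient topology on `P(ℝ^d) = (ℝ^d ∖ {0}) / ℝ^*`. -/
noncomputable instance instTopologicalSpaceProjSpace (d : ℕ) : TopologicalSpace (ProjSpace d) :=
  TopologicalSpace.coinduced (Projectivization.mk' (K := ℝ) (V := Fin d → ℝ)) inferInstance

/-- `P(ℝ^d)` carries its Borel σ-algebra. -/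
noncomputable instance instMeasurableSpaceProjSpace (d : ℕ) : MeasurableSpace (ProjSpace d) :=
  borel (ProjSpace d)

instance instBorelSpaceProjSpace (d : ℕ) : BorelSpace (ProjSpace d) := ⟨rfl⟩

/-- The group `GL(d)` acts on `P(ℝ^d)` by `A [v] = [A v]`. -/
theorem smul_mk_eq {d : ℕ} (A : Matrix.GeneralLinearGroup (Fin d) ℝ) (v : Fin d → ℝ)
    (hv : v ≠ 0) (hAv : (A : Matrix (Fin d) (Fin d) ℝ).mulVec v ≠ 0) :
    A • (Projectivization.mk ℝ v hv : ProjSpace d) =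
      Projectivization.mk ℝ ((A : Matrix (Fin d) (Fin d) ℝ).mulVec v) hAv := rfl

/-- The norm of a matrix as an operator on Euclidean space `ℝ^d`. -/
noncomputable def opNorm {d : ℕ} (A : Matrix.GeneralLinearGroup (Fin d) ℝ) : ℝ :=
  ‖Matrix.toEuclideanCLM (n := Fin d) (𝕜 := ℝ) (A : Matrix (Fin d) (Fin d) ℝ)‖

/-- Measurability of a `GL(d)`-valued map: all matrix entries are measurable. Since `GL(d)` is a
topological subspace of `ℝ^{d × d}`, this is Borel measurability. -/
def MeasurableGL {α : Type*} [MeasurableSpace α] {d : ℕ}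
    (A : α → Matrix.GeneralLinearGroup (Fin d) ℝ) : Prop :=
  ∀ i j, Measurable fun x => (A x : Matrix (Fin d) (Fin d) ℝ) i j

/-- The iterates `A^n(x) = A(T^{n-1} x) ⋯ A(T x) A(x)` of a cocycle `A` over `T`. -/
def cocycleIter {α : Type*} {d : ℕ} (T : α → α) (A : α → Matrix.GeneralLinearGroup (Fin d) ℝ) :
    ℕ → α → Matrix.GeneralLinearGroup (Fin d) ℝ
  | 0, _ => 1
  | n + 1, x => A (T^[n] x) * cocycleIter T A n x

section Lyapunov

variable {α : Type*} [MeasurableSpace α] {d : ℕ}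

/-- The maximal Lyapunov exponent `λ_+(A)`, the `m`-almost everywhere constant value of
`lim (1/n) log ‖A^n(x)‖`. It is written with `limsup` and an essential supremum in the extended
reals so as to be defined before the limit is known to exist; see `lyapunovMax_eq`. -/
noncomputable def lyapunovMax (m : Measure α) (T : α → α)
    (A : α → Matrix.GeneralLinearGroup (Fin d) ℝ) : EReal :=
  essSup (fun x => limsup
    (fun n : ℕ => (((1 / (n : ℝ)) * Real.log (opNorm (cocycleIter T A n x)) : ℝ) : EReal)) atTop) m

/-- The minimal Lyapunov exponent `λ_-(A)`, the `m`-almost everywhere constant value of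
`lim (1/n) log ‖A^n(x)⁻¹‖⁻¹`; see `lyapunovMin_eq`. -/
noncomputable def lyapunovMin (m : Measure α) (T : α → α)
    (A : α → Matrix.GeneralLinearGroup (Fin d) ℝ) : EReal :=
  essInf (fun x => liminf
    (fun n : ℕ => (((1 / (n : ℝ)) * Real.log ((opNorm ((cocycleIter T A n x)⁻¹))⁻¹) : ℝ) : EReal))
    atTop) m

theorem lyapunovMax_eq (m : Measure α) [NeZero m] (T : α → α)
    (A : α → Matrix.GeneralLinearGroup (Fin d) ℝ) (lam : ℝ)
    (h : ∀ᵐ x ∂m, Tendsto (fun n : ℕ => (1 / (n : ℝ)) * Real.log (opNorm (cocycleIter T A n x)))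
      atTop (𝓝 lam)) :
    lyapunovMax m T A = lam := by
  have h' : (fun x => limsup
      (fun n : ℕ => (((1 / (n : ℝ)) * Real.log (opNorm (cocycleIter T A n x)) : ℝ) : EReal)) atTop)
      =ᵐ[m] fun _ => (lam : EReal) := by
    filter_upwards [h] with x hx
    exact (continuous_coe_real_ereal.tendsto lam |>.comp hx).limsup_eq
  rw [lyapunovMax, essSup_congr_ae h', essSup_const _ (NeZero.ne m)]

theorem lyapunovMin_eq (m : Measure α) [NeZero m] (T : α → α)
    (A : α → Matrix.GeneralLinearGroup (Fin d) ℝ) (lam : ℝ)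
    (h : ∀ᵐ x ∂m, Tendsto
      (fun n : ℕ => (1 / (n : ℝ)) * Real.log ((opNorm ((cocycleIter T A n x)⁻¹))⁻¹)) atTop (𝓝 lam)) :
    lyapunovMin m T A = lam := by
  have h' : (fun x => liminf
      (fun n : ℕ => (((1 / (n : ℝ)) * Real.log ((opNorm ((cocycleIter T A n x)⁻¹))⁻¹) : ℝ) : EReal))
      atTop) =ᵐ[m] fun _ => (lam : EReal) := by
    filter_upwards [h] with x hx
    exact (continuous_coe_real_ereal.tendsto lam |>.comp hx).liminf_eq
  rw [lyapunovMin, essInf_congr_ae h', essInf_const _ (NeZero.ne m)]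

end Lyapunov

section Cocycle

variable {X Y : Type*} [MeasurableSpace X] [MeasurableSpace Y]

/-- The Bernoulli measure `ℙ = p^ℤ` on `Ω = Y^ℤ`. -/
noncomputable def bernoulliMeasure (p : Measure Y) [IsProbabilityMeasure p] : Measure (ℤ → Y) :=
  Measure.infinitePi fun _ : ℤ => p

/-- The measure `ℙ × μ` on `Ω × X`. -/
noncomputable def barMeasure (p : Measure Y) [IsProbabilityMeasure p] (μ : Measure X) :
    Measure ((ℤ → Y) × X) :=
  (bernoulliMeasure p).prod μ

/-- The skew-shift `(ω, x) ↦ (θ ω, f_{ω₀}(x))` on `Ω × X`, where `θ` is the shift. -/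
def skewShift (f : Y → X → X) (z : (ℤ → Y) × X) : (ℤ → Y) × X :=
  (fun n => z.1 (n + 1), f (z.1 0) z.2)

/-- The skew-shift of `f` is an (ergodic) random transformation: it is measurable, preserves
`ℙ × μ`, is ergodic, and is invertible (modulo null sets) with measurable inverse. -/
structure IsRandomTransformation (p : Measure Y) [IsProbabilityMeasure p] (μ : Measure X)
    (f : Y → X → X) : Prop where
  ergodic : Ergodic (skewShift f) (barMeasure p μ)
  invertible : ∃ g : (ℤ → Y) × X → (ℤ → Y) × X, Measurable g ∧
    (∀ᵐ z ∂barMeasure p μ, g (skewShift f z) = z) ∧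
    (∀ᵐ z ∂barMeasure p μ, skewShift f (g z) = z)

/-- `(skewShift f, A)` is a random `GL(d)`-valued cocycle with fiber cocycles `(f i, Afib i)`. -/
structure IsRandomCocycle {d : ℕ} (p : Measure Y) [IsProbabilityMeasure p] (μ : Measure X)
    (f : Y → X → X) (A : (ℤ → Y) × X → Matrix.GeneralLinearGroup (Fin d) ℝ)
    (Afib : Y → X → Matrix.GeneralLinearGroup (Fin d) ℝ) : Prop
    extends IsRandomTransformation p μ f where
  measurable : MeasurableGL A
  measurable_fib : MeasurableGL fun z : Y × X => Afib z.1 z.2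
  locally_constant : ∀ᵐ z ∂barMeasure p μ, A z = Afib (z.1 0) z.2

/-- The skew-product `F_i(x, z) = (f_i(x), A_i(x) z)` on `X × P(ℝ^d)`. -/
noncomputable def fiberMap {d : ℕ} (fi : X → X) (Ai : X → Matrix.GeneralLinearGroup (Fin d) ℝ)
    (q : X × ProjSpace d) : X × ProjSpace d :=
  (fi q.1, Ai q.1 • q.2)

/-- An invariant measure of the random cocycle: it projects on `μ` and is invariant under the
fiber map `F_i` for `p`-almost every `i`. -/
structure IsInvariantMeasure {d : ℕ} (p : Measure Y) (μ : Measure X)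
    (f : Y → X → X) (Afib : Y → X → Matrix.GeneralLinearGroup (Fin d) ℝ)
    (η : Measure (X × ProjSpace d)) : Prop where
  projects : η.map Prod.fst = μ
  invariant : ∀ᵐ i ∂p, MeasurePreserving (fiberMap (f i) (Afib i)) η η

end Cocycle

end RandomCocycle

/-!
The invariant measure is a weak limit of Cesàro averages of the laws of a random orbit of the
skew-product `F_i(x, z) = (f_i(x), A_i(x) z)`, started from `μ × m`, where `m` is a measure of
Lebesgue class on projective space (`refMeasure`). The limit of such averages is always stationary,
that is, invariant under the average over `i` of the maps `F_i`. Equality of the exponents is used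
to show that it is invariant under almost every single `F_i`.

Almost every `f_i` preserves `μ`, because `ω₀` is determined by the image of `(ω, x)` under the
skew-shift. Hence `F_i` distorts `Λ = μ × m` by the Jacobian `J_i(x, z)` of `A_i(x)` on projective
space (`hasJacobian_fiberMaps`), and the law `η_n` of the orbit at time `n` has a density `ψ_n` with
respect to `Λ`. Along the random orbit `q_{n+1} = F_{ω_n}(q_n)` consider the ratios
`R_n = ψ_{n+1}(q_{n+1}) J_{ω_n}(q_n) / ψ_n(q_n)`. Their product telescopes to
`ψ_N(q_N) · ∏ J_{ω_n}(q_n)`, and `1 - √R ≤ -(1/2) log R`, so that `∑_{n<N} (1 - E √R_n)` is bounded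
by `(1/2) (1 + E |∑ log J_{ω_n}(q_n)|)` (`HasJacobian.sum_one_sub_integral_sqrtRatio_le`). On the
other hand `1 - E √R_n` is half the squared Hellinger distance between `p × η_n` and the measure obtained
by transporting `η_{n+1}` back by the maps `F_i`; it therefore controls the total variation, and
with it the mean over `i` of `|∫ g ∘ F_i dη_n - ∫ g dη_{n+1}|` for bounded `g`
(`HasJacobian.sum_integral_abs_integral_sub_le`).

By the chain rule `∑_{n<N} log J_{ω_n}(q_n)` is the logarithm of the Jacobian of `A^N`, which is at
most `d log (‖A^N‖ ‖(A^N)⁻¹‖)` up to a constant. If the extremal exponents coincide, this is `o(N)`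
almost everywhere, and also in mean, as it is dominated by Birkhoff sums of the integrable function
`log⁺ ‖A‖ + log⁺ ‖A⁻¹‖` (`tendsto_integral_logCond`). Thus the defects of invariance tend to zero in
the sense of Cesàro (`tendsto_average_defect`).

All the laws `η_n` project to `μ`, so that their Cesàro averages are tight and have a weak limit for
any Polish topology on `X`. The functions `g ∘ F_i`, for `g` continuous, are only measurable in `x`,
but they are continuous in `z`; since all the averages have the same marginal `μ`, the integrals of
such functions pass to the limit (`tendsto_integral_of_continuous_snd`), and so does the vanishing
of the defect (`exists_ae_measurePreserving`).
-/

namespace RandomCocycle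

/-! ### The topology of projective space -/

section ProjectiveSpace

variable {d : ℕ}

theorem continuous_mk' : Continuous
    (Projectivization.mk' ℝ : {v : Fin d → ℝ // v ≠ 0} → ProjSpace d) :=
  continuous_coinduced_rng

theorem surjective_mk' : Function.Surjective
    (Projectivization.mk' ℝ : {v : Fin d → ℝ // v ≠ 0} → ProjSpace d) :=
  fun z => ⟨⟨z.rep, z.rep_nonzero⟩, z.mk_rep⟩

theorem continuous_iff_comp_mk' {β : Type*} [TopologicalSpace β] {f : ProjSpace d → β} :
    Continuous f ↔
      Continuous fun v : {v : Fin d → ℝ // v ≠ 0} => f (Projectivization.mk' ℝ v) :=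
  continuous_coinduced_dom

/-- The matrix of the Euclidean orthogonal projection onto a line. It embeds projective space into
a space of matrices. -/
noncomputable def orthProj (z : ProjSpace d) (i j : Fin d) : ℝ :=
  z.rep i * z.rep j / (z.rep ⬝ᵥ z.rep)

theorem orthProj_mk (v : Fin d → ℝ) (hv : v ≠ 0) (i j : Fin d) :
    orthProj (Projectivization.mk ℝ v hv) i j = v i * v j / (v ⬝ᵥ v) := by
  obtain ⟨a, ha⟩ := Projectivization.exists_smul_eq_mk_rep ℝ v hv
  have ha0 : (a : ℝ) ≠ 0 := a.ne_zero
  have hr : (Projectivization.mk ℝ v hv : ProjSpace d).rep = (a : ℝ) • v := ha.symm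
  have hvv : v ⬝ᵥ v ≠ 0 := by simpa [dotProduct_self_eq_zero] using hv
  simp only [orthProj, hr, Pi.smul_apply, smul_eq_mul, dotProduct_smul, smul_dotProduct]
  field_simp

theorem continuous_orthProj : Continuous (orthProj : ProjSpace d → Fin d → Fin d → ℝ) := by
  rw [continuous_iff_comp_mk']
  have : (fun v : {v : Fin d → ℝ // v ≠ 0} => orthProj (Projectivization.mk' ℝ v)) =
      fun v i j => v.1 i * v.1 j / (v.1 ⬝ᵥ v.1) := by
    funext v i j
    exact orthProj_mk v.1 v.2 i j
  rw [this]
  have hc : ∀ i, Continuous fun v : {v : Fin d → ℝ // v ≠ 0} => v.1 i := fun i =>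
    (continuous_apply i).comp continuous_subtype_val
  refine continuous_pi fun i => continuous_pi fun j => Continuous.div ?_ ?_ fun v => ?_
  · exact (hc i).mul (hc j)
  · exact continuous_finsetSum _ fun k _ => (hc k).mul (hc k)
  · simpa [dotProduct_self_eq_zero] using v.2

theorem orthProj_injective :
    Function.Injective (orthProj : ProjSpace d → Fin d → Fin d → ℝ) := by
  intro z w h
  induction z using Projectivization.ind with | _ v hv =>
  induction w using Projectivization.ind with | _ u hu =>
  have hvv : v ⬝ᵥ v ≠ 0 := by simpa [dotProduct_self_eq_zero] using hv
  have huu : u ⬝ᵥ u ≠ 0 := by simpa [dotProduct_self_eq_zero] using hu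
  have key : ∀ i j, v i * v j / (v ⬝ᵥ v) = u i * u j / (u ⬝ᵥ u) := fun i j => by
    rw [← orthProj_mk v hv, ← orthProj_mk u hu, h]
  obtain ⟨i, hi⟩ := Function.ne_iff.1 hv
  rw [Projectivization.mk_eq_mk_iff']
  refine ⟨(v ⬝ᵥ v) * u i / ((u ⬝ᵥ u) * v i), ?_⟩
  funext j
  have hi' : v i ≠ 0 := hi
  have := key i j
  rw [div_eq_div_iff hvv huu] at this
  simp only [Pi.smul_apply, smul_eq_mul]
  field_simp
  linarith

instance instT2SpaceProjSpace : T2Space (ProjSpace d) :=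
  T2Space.of_injective_continuous orthProj_injective continuous_orthProj

/-- The line spanned by a unit vector. -/
noncomputable def sphereMk (u : Metric.sphere (0 : Fin d → ℝ) 1) : ProjSpace d :=
  Projectivization.mk ℝ u.1 (ne_zero_of_mem_unit_sphere u)

theorem continuous_sphereMk : Continuous (sphereMk : _ → ProjSpace d) :=
  continuous_mk'.comp
    (Continuous.subtype_mk continuous_subtype_val fun u => ne_zero_of_mem_unit_sphere u)

theorem sphereMk_surjective : Function.Surjective (sphereMk : _ → ProjSpace d) := by
  intro z
  induction z using Projectivization.ind with | _ v hv =>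
  have hn : ‖v‖ ≠ 0 := norm_ne_zero_iff.2 hv
  refine ⟨⟨‖v‖⁻¹ • v, by simp [norm_smul, hn]⟩, ?_⟩
  exact (Projectivization.mk_eq_mk_iff' ℝ _ _ _ _).2 ⟨‖v‖⁻¹, rfl⟩

instance instCompactSpaceProjSpace : CompactSpace (ProjSpace d) :=
  sphereMk_surjective.compactSpace continuous_sphereMk

theorem isClosedEmbedding_orthProj :
    IsClosedEmbedding (orthProj : ProjSpace d → Fin d → Fin d → ℝ) :=
  continuous_orthProj.isClosedEmbedding orthProj_injective

instance instSecondCountableTopologyProjSpace : SecondCountableTopology (ProjSpace d) :=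
  isClosedEmbedding_orthProj.isEmbedding.secondCountableTopology

instance instPolishSpaceProjSpace : PolishSpace (ProjSpace d) :=
  isClosedEmbedding_orthProj.polishSpace

/-! ### The projective action and its Jacobian -/

theorem mulVec_ne_zero (B : Matrix.GeneralLinearGroup (Fin d) ℝ) {v : Fin d → ℝ} (hv : v ≠ 0) :
    (B : Matrix (Fin d) (Fin d) ℝ).mulVec v ≠ 0 := by
  intro h
  apply hv
  have := congrArg ((B⁻¹ : Matrix.GeneralLinearGroup (Fin d) ℝ) :
    Matrix (Fin d) (Fin d) ℝ).mulVec h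
  simpa [Matrix.mulVec_mulVec, ← Units.val_mul] using this

theorem continuous_smul_projSpace (B : Matrix.GeneralLinearGroup (Fin d) ℝ) :
    Continuous fun z : ProjSpace d => B • z := by
  rw [continuous_iff_comp_mk']
  have : Continuous fun v : {v : Fin d → ℝ // v ≠ 0} =>
      (⟨(B : Matrix (Fin d) (Fin d) ℝ).mulVec v.1, mulVec_ne_zero B v.2⟩ :
        {v : Fin d → ℝ // v ≠ 0}) := by
    refine Continuous.subtype_mk ?_ _
    exact Continuous.matrix_mulVec continuous_const continuous_subtype_val
  exact continuous_mk'.comp this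

/-- The Jacobian at the line `z` of the action of `B` on projective space, relative to the radial
projection of Lebesgue measure on the unit ball of the sup norm: it is
`|det B| (‖v‖ / ‖B v‖) ^ d` for any `v` spanning `z`. It is defined for all matrices, with a junk
value on singular ones, so that its joint measurability can be stated on a product space. -/
noncomputable def projJac (B : Matrix (Fin d) (Fin d) ℝ) (z : ProjSpace d) : ℝ :=
  |B.det| * (‖z.rep‖ / ‖B.mulVec z.rep‖) ^ d

theorem projJac_mk (B : Matrix (Fin d) (Fin d) ℝ) (v : Fin d → ℝ) (hv : v ≠ 0) :
    projJac B (Projectivization.mk ℝ v hv) = |B.det| * (‖v‖ / ‖B.mulVec v‖) ^ d := by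
  obtain ⟨a, ha⟩ := Projectivization.exists_smul_eq_mk_rep ℝ v hv
  have ha0 : ‖(a : ℝ)‖ ≠ 0 := norm_ne_zero_iff.2 a.ne_zero
  have hr : (Projectivization.mk ℝ v hv : ProjSpace d).rep = (a : ℝ) • v := ha.symm
  rw [projJac, hr, Matrix.mulVec_smul, norm_smul, norm_smul, mul_div_mul_left _ _ ha0]

theorem det_ne_zero (B : Matrix.GeneralLinearGroup (Fin d) ℝ) :
    (B : Matrix (Fin d) (Fin d) ℝ).det ≠ 0 :=
  (Matrix.GeneralLinearGroup.det B).ne_zero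

theorem projJac_pos (B : Matrix.GeneralLinearGroup (Fin d) ℝ) (z : ProjSpace d) :
    0 < projJac (B : Matrix (Fin d) (Fin d) ℝ) z :=
  mul_pos (abs_pos.2 (det_ne_zero B)) (pow_pos (div_pos (norm_pos_iff.2 z.rep_nonzero)
    (norm_pos_iff.2 (mulVec_ne_zero B z.rep_nonzero))) _)

theorem projJac_one (z : ProjSpace d) :
    projJac ((1 : Matrix.GeneralLinearGroup (Fin d) ℝ) : Matrix (Fin d) (Fin d) ℝ) z = 1 := by
  simp [projJac, norm_ne_zero_iff.2 z.rep_nonzero]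

/-- The chain rule for the projective action. -/
theorem projJac_mul (B C : Matrix.GeneralLinearGroup (Fin d) ℝ) (z : ProjSpace d) :
    projJac ((B * C : Matrix.GeneralLinearGroup (Fin d) ℝ) : Matrix (Fin d) (Fin d) ℝ) z =
      projJac (B : Matrix (Fin d) (Fin d) ℝ) (C • z) *
        projJac (C : Matrix (Fin d) (Fin d) ℝ) z := by
  induction z using Projectivization.ind with | _ v hv =>
  have h1 := norm_ne_zero_iff.2 (mulVec_ne_zero C hv)
  rw [smul_mk_eq C v hv (mulVec_ne_zero C hv), projJac_mk, projJac_mk, projJac_mk,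
    Units.val_mul, Matrix.det_mul, abs_mul, ← Matrix.mulVec_mulVec, mul_mul_mul_comm, ← mul_pow]
  congr 2
  rw [mul_comm, div_mul_div_cancel₀ h1]

/-- Measurability on `M × P(ℝ^d)` may be checked on `M × (ℝ^d ∖ {0})`, since a measurable surjection
of standard Borel spaces is a quotient map of measurable spaces. -/
theorem measurable_iff_comp_mk' {M β : Type*} [MeasurableSpace M] [StandardBorelSpace M]
    [MeasurableSpace β] {g : M × ProjSpace d → β} :
    Measurable g ↔ Measurable fun q : M × {v : Fin d → ℝ // v ≠ 0} =>
      g (q.1, Projectivization.mk' ℝ q.2) := by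
  have : StandardBorelSpace {v : Fin d → ℝ // v ≠ 0} :=
    (measurableSet_singleton (0 : Fin d → ℝ)).compl.standardBorel
  have hm : Measurable fun q : M × {v : Fin d → ℝ // v ≠ 0} =>
      ((q.1, Projectivization.mk' ℝ q.2) : M × ProjSpace d) :=
    measurable_fst.prodMk (continuous_mk'.measurable.comp measurable_snd)
  have hs : Function.Surjective fun q : M × {v : Fin d → ℝ // v ≠ 0} =>
      ((q.1, Projectivization.mk' ℝ q.2) : M × ProjSpace d) := by
    rintro ⟨m, z⟩
    obtain ⟨v, rfl⟩ := surjective_mk' z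
    exact ⟨(m, v), rfl⟩
  exact (hm.measurable_comp_iff_of_surjective hs).symm

theorem measurable_mulVec_uncurry : Measurable
    fun q : (Fin d → Fin d → ℝ) × (Fin d → ℝ) => (Matrix.of q.1).mulVec q.2 := by
  refine measurable_pi_lambda _ fun i => ?_
  simp only [Matrix.mulVec, dotProduct, Matrix.of_apply]
  fun_prop

theorem measurable_projJac_uncurry : Measurable
    fun q : (Fin d → Fin d → ℝ) × ProjSpace d => projJac (Matrix.of q.1) q.2 := by
  rw [measurable_iff_comp_mk']
  have : (fun q : (Fin d → Fin d → ℝ) × {v : Fin d → ℝ // v ≠ 0} =>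
      projJac (Matrix.of q.1) (Projectivization.mk' ℝ q.2)) = fun q =>
      |(Matrix.of q.1).det| * (‖q.2.1‖ / ‖(Matrix.of q.1).mulVec q.2.1‖) ^ d := by
    funext q
    exact projJac_mk _ _ q.2.2
  rw [this]
  have h1 : Measurable fun q : (Fin d → Fin d → ℝ) × {v : Fin d → ℝ // v ≠ 0} =>
      (Matrix.of q.1).mulVec q.2.1 :=
    measurable_mulVec_uncurry.comp
      (measurable_fst.prodMk (measurable_subtype_coe.comp measurable_snd))
  have h2 : Measurable fun q : (Fin d → Fin d → ℝ) × {v : Fin d → ℝ // v ≠ 0} =>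
      (Matrix.of q.1).det := by
    simp only [Matrix.det_apply, Matrix.of_apply]
    fun_prop
  exact (h2.abs).mul (((measurable_subtype_coe.comp measurable_snd).norm.div h1.norm).pow_const _)

theorem MeasurableGL.measurable_entries {α : Type*} [MeasurableSpace α]
    {A : α → Matrix.GeneralLinearGroup (Fin d) ℝ} (hA : MeasurableGL A) :
    Measurable fun a => (fun i j => (A a : Matrix (Fin d) (Fin d) ℝ) i j) :=
  measurable_pi_lambda _ fun i => measurable_pi_lambda _ fun j => hA i j

theorem MeasurableGL.measurable_projJac {α : Type*} [MeasurableSpace α]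
    {A : α → Matrix.GeneralLinearGroup (Fin d) ℝ} (hA : MeasurableGL A) :
    Measurable fun q : α × ProjSpace d => projJac (A q.1 : Matrix (Fin d) (Fin d) ℝ) q.2 :=
  measurable_projJac_uncurry.comp
    ((hA.measurable_entries.comp measurable_fst).prodMk measurable_snd)

/-- The projective action is jointly measurable. The invertible matrices form a Borel subset `U` of
`ℝ^{d × d}`, and it suffices to treat the action of `U`. -/
theorem MeasurableGL.measurable_smul {α : Type*} [MeasurableSpace α]
    {A : α → Matrix.GeneralLinearGroup (Fin d) ℝ} (hA : MeasurableGL A) :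
    Measurable fun q : α × ProjSpace d => A q.1 • q.2 := by
  let U : Set (Fin d → Fin d → ℝ) := {M | (Matrix.of M).det ≠ 0}
  have hU : MeasurableSet U := by
    have h2 : Measurable fun M : Fin d → Fin d → ℝ => (Matrix.of M).det := by
      simp only [Matrix.det_apply, Matrix.of_apply]
      fun_prop
    exact (h2 (measurableSet_singleton 0)).compl
  have : StandardBorelSpace U := hU.standardBorel
  let G : U × ProjSpace d → ProjSpace d := fun q =>
    Matrix.GeneralLinearGroup.mkOfDetNeZero (Matrix.of q.1.1) q.1.2 • q.2
  have hG : Measurable G := by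
    rw [measurable_iff_comp_mk']
    have h1 : Measurable fun q : U × {v : Fin d → ℝ // v ≠ 0} =>
        (Matrix.of q.1.1).mulVec q.2.1 :=
      measurable_mulVec_uncurry.comp
        ((measurable_subtype_coe.comp measurable_fst).prodMk
          (measurable_subtype_coe.comp measurable_snd))
    exact continuous_mk'.measurable.comp (h1.subtype_mk (p := fun v : Fin d → ℝ => v ≠ 0) (h :=
      fun q => mulVec_ne_zero
        (Matrix.GeneralLinearGroup.mkOfDetNeZero (Matrix.of q.1.1) q.1.2) q.2.2))
  have hmem : ∀ a, (fun i j => (A a : Matrix (Fin d) (Fin d) ℝ) i j) ∈ U := fun a =>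
    det_ne_zero (A a)
  have hAU : Measurable fun a =>
      (⟨fun i j => (A a : Matrix (Fin d) (Fin d) ℝ) i j, hmem a⟩ : U) :=
    hA.measurable_entries.subtype_mk
  have : (fun q : α × ProjSpace d => A q.1 • q.2) = fun q =>
      G (⟨fun i j => (A q.1 : Matrix (Fin d) (Fin d) ℝ) i j, hmem q.1⟩, q.2) := by
    funext q
    have : A q.1 = Matrix.GeneralLinearGroup.mkOfDetNeZero
        (Matrix.of fun i j => (A q.1 : Matrix (Fin d) (Fin d) ℝ) i j) (det_ne_zero (A q.1)) := by
      ext i j; rfl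
    exact congrArg (· • q.2) this
  rw [this]
  exact hG.comp ((hAU.comp measurable_fst).prodMk measurable_snd)

end ProjectiveSpace

/-! ### The reference measure on projective space -/

section ReferenceMeasure

variable {d : ℕ}

/-- The probability measure on `P(ℝ^d)` obtained by radial projection of Lebesgue measure on the
unit ball of the sup norm. -/
noncomputable def refMeasure (d : ℕ) : Measure (ProjSpace d) :=
  ((volume : Measure (Fin d → ℝ)).toSphere Set.univ)⁻¹ •
    (volume : Measure (Fin d → ℝ)).toSphere.map sphereMk

theorem isProbabilityMeasure_refMeasure (hd : 1 ≤ d) : IsProbabilityMeasure (refMeasure d) := by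
  have : Nonempty (Fin d) := ⟨⟨0, hd⟩⟩
  constructor
  rw [refMeasure, Measure.smul_apply, Measure.map_apply continuous_sphereMk.measurable .univ,
    Set.preimage_univ, smul_eq_mul]
  refine ENNReal.inv_mul_cancel ?_ (measure_ne_top _ _)
  rw [Ne, Measure.measure_univ_eq_zero]
  exact Measure.toSphere_ne_zero _

/-- The function on `ℝ^d`, homogeneous of degree zero, induced by a function on projective space;
its value at the origin is set to `0`. -/
noncomputable def homExt (h : ProjSpace d → ENNReal) (y : Fin d → ℝ) : ENNReal :=
  open Classical in if hy : y = 0 then 0 else h (Projectivization.mk ℝ y hy)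

theorem homExt_zero (h : ProjSpace d → ENNReal) : homExt h 0 = 0 := dif_pos rfl

theorem homExt_of_ne_zero (h : ProjSpace d → ENNReal) {y : Fin d → ℝ} (hy : y ≠ 0) :
    homExt h y = h (Projectivization.mk ℝ y hy) := dif_neg hy

theorem measurable_homExt {h : ProjSpace d → ENNReal} (hh : Measurable h) :
    Measurable (homExt h) := by
  classical
  exact Measurable.dite (s := {y : Fin d → ℝ | y = 0}) measurable_const
    (hh.comp continuous_mk'.measurable) (measurableSet_singleton 0)

theorem homExt_smul_sphere (h : ProjSpace d → ENNReal) (u : Metric.sphere (0 : Fin d → ℝ) 1)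
    {r : ℝ} (hr : 0 < r) : homExt h (r • u.1) = h (sphereMk u) := by
  rw [homExt_of_ne_zero h (smul_ne_zero hr.ne' (ne_zero_of_mem_unit_sphere u))]
  congr 1
  exact (Projectivization.mk_eq_mk_iff' ℝ _ _ _ _).2 ⟨r, rfl⟩

theorem measurable_mulVec (B : Matrix (Fin d) (Fin d) ℝ) :
    Measurable fun x : Fin d → ℝ => B.mulVec x :=
  (Continuous.matrix_mulVec continuous_const continuous_id).measurable

/-- Integration in polar coordinates of a function that is homogeneous of degree zero, over the
preimage of the unit ball under `B`. -/
theorem lintegral_preimage_ball (hd : 1 ≤ d) (B : Matrix.GeneralLinearGroup (Fin d) ℝ)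
    {h : ProjSpace d → ENNReal} (hh : Measurable h) :
    ∫⁻ x : Fin d → ℝ, homExt h x * (Metric.ball (0 : Fin d → ℝ) 1).indicator 1
          ((B : Matrix (Fin d) (Fin d) ℝ).mulVec x) =
      ∫⁻ u, h (sphereMk u) *
        ENNReal.ofReal (‖(B : Matrix (Fin d) (Fin d) ℝ).mulVec u.1‖⁻¹ ^ d / d)
          ∂(volume : Measure (Fin d → ℝ)).toSphere := by
  set M : Matrix (Fin d) (Fin d) ℝ := (B : Matrix (Fin d) (Fin d) ℝ) with hM
  set G : (Fin d → ℝ) → ENNReal := fun x =>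
    homExt h x * (Metric.ball (0 : Fin d → ℝ) 1).indicator 1 (M.mulVec x) with hG
  have hG0 : G 0 = 0 := by simp [hG, homExt_zero]
  have hmeas : Measurable G := (measurable_homExt hh).mul
    ((measurable_one.indicator Metric.isOpen_ball.measurableSet).comp (measurable_mulVec M))
  have hP := ((volume : Measure (Fin d → ℝ)).measurePreserving_homeomorphUnitSphereProd).symm
    (homeomorphUnitSphereProd (Fin d → ℝ)).toMeasurableEquiv
  have hcomap : ∫⁻ x, G x =
      ∫⁻ x : ({0}ᶜ : Set (Fin d → ℝ)), G x.1 ∂(volume.comap Subtype.val) := by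
    rw [lintegral_subtype_comap (measurableSet_singleton 0).compl,
      ← lintegral_indicator (measurableSet_singleton 0).compl]
    refine lintegral_congr fun x => ?_
    by_cases hx : x = 0
    · simp [hx, hG0]
    · simp [hx]
  have hGm : Measurable fun x : ({0}ᶜ : Set (Fin d → ℝ)) => G x.1 :=
    hmeas.comp measurable_subtype_coe
  rw [hcomap, ← hP.lintegral_comp hGm]
  refine (lintegral_prod _ (hGm.comp hP.measurable).aemeasurable).trans
    (lintegral_congr fun u => ?_)
  simp only [Function.comp_apply]
  have hBu : 0 < ‖M.mulVec u.1‖ :=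
    norm_pos_iff.2 (mulVec_ne_zero B (ne_zero_of_mem_unit_sphere u))
  have hset : ∀ r : Set.Ioi (0 : ℝ),
      G ((homeomorphUnitSphereProd (Fin d → ℝ)).toMeasurableEquiv.symm (u, r)).1 =
      h (sphereMk u) *
        (Set.Iio (⟨‖M.mulVec u.1‖⁻¹, Set.mem_Ioi.2 (inv_pos.2 hBu)⟩ :
          Set.Ioi (0 : ℝ))).indicator 1 r := by
    intro r
    have hr : 0 < r.1 := r.2
    have hv : ((homeomorphUnitSphereProd (Fin d → ℝ)).toMeasurableEquiv.symm (u, r)).1 =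
        r.1 • u.1 := homeomorphUnitSphereProd_symm_apply_coe _ _
    have hmem : (r.1 • M.mulVec u.1 ∈ Metric.ball (0 : Fin d → ℝ) 1) ↔
        r ∈ Set.Iio (⟨‖M.mulVec u.1‖⁻¹, Set.mem_Ioi.2 (inv_pos.2 hBu)⟩ : Set.Ioi (0 : ℝ)) := by
      rw [mem_ball_zero_iff, norm_smul, Real.norm_of_nonneg hr.le, Set.mem_Iio,
        ← Subtype.coe_lt_coe]
      change r.1 * ‖M.mulVec u.1‖ < 1 ↔ r.1 < ‖M.mulVec u.1‖⁻¹
      rw [← one_div, lt_div_iff₀ hBu]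
    rw [hv, hG]
    simp only [homExt_smul_sphere h u hr, Matrix.mulVec_smul]
    congr 1
    by_cases hm : r.1 • M.mulVec u.1 ∈ Metric.ball (0 : Fin d → ℝ) 1
    · rw [Set.indicator_of_mem hm, Set.indicator_of_mem (hmem.1 hm)]; rfl
    · rw [Set.indicator_of_notMem hm, Set.indicator_of_notMem (fun h' => hm (hmem.2 h'))]
  rw [lintegral_congr hset, lintegral_const_mul _ (measurable_one.indicator measurableSet_Iio),
    lintegral_indicator_one measurableSet_Iio, Measure.volumeIoiPow_apply_Iio,
    Module.finrank_fin_fun, Nat.sub_add_cancel hd, Nat.cast_pred hd, sub_add_cancel]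

/-- Change of variables on projective space: `B` takes the measure of density `projJac B` to the
reference measure. Lifted to homogeneous functions on `ℝ^d`, this is the linear change of variables
`y = B x` on the unit ball. -/
theorem lintegral_smul_mul_projJac (hd : 1 ≤ d) (B : Matrix.GeneralLinearGroup (Fin d) ℝ)
    {h : ProjSpace d → ENNReal} (hh : Measurable h) :
    ∫⁻ z, h (B • z) * ENNReal.ofReal (projJac (B : Matrix (Fin d) (Fin d) ℝ) z)
      ∂(refMeasure d) = ∫⁻ z, h z ∂(refMeasure d) := by
  set M : Matrix (Fin d) (Fin d) ℝ := (B : Matrix (Fin d) (Fin d) ℝ) with hM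
  have hdet : M.det ≠ 0 := det_ne_zero B
  have hd0 : (0 : ℝ) < d := by exact_mod_cast hd
  have hJ : Measurable fun z : ProjSpace d => projJac M z :=
    measurable_projJac_uncurry.comp (measurable_prodMk_left (x := fun i j => M i j))
  have hB := (continuous_smul_projSpace B).measurable
  have hhB : Measurable fun z => h (B • z) := hh.comp hB
  let H : (Fin d → ℝ) → ENNReal := fun y =>
    homExt h y * (Metric.ball (0 : Fin d → ℝ) 1).indicator 1 y
  have hH : Measurable H := (measurable_homExt hh).mul
    (measurable_one.indicator Metric.isOpen_ball.measurableSet)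
  have hone := lintegral_preimage_ball hd 1 hh
  have hBint := lintegral_preimage_ball hd B hhB
  simp only [Units.val_one, Matrix.one_mulVec] at hone
  -- The linear change of variables `y = B x` in `ℝ^d`.
  have hlin : ∫⁻ x : Fin d → ℝ, homExt (fun z => h (B • z)) x *
      (Metric.ball (0 : Fin d → ℝ) 1).indicator 1 (M.mulVec x) =
      ENNReal.ofReal |M.det⁻¹| * ∫⁻ y, H y := by
    rw [← smul_eq_mul, ← lintegral_smul_measure,
      ← Real.map_matrix_volume_pi_eq_smul_volume_pi hdet, lintegral_map hH
      (LinearMap.continuous_of_finiteDimensional _).measurable]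
    refine lintegral_congr fun x => ?_
    simp only [H, Matrix.toLin'_apply]
    congr 1
    by_cases hx : x = 0
    · simp [hx, homExt_zero]
    · rw [homExt_of_ne_zero _ hx, homExt_of_ne_zero _ (mulVec_ne_zero B hx)]
      rfl
  rw [hlin, hone] at hBint
  simp only [refMeasure, lintegral_smul_measure]
  congr 1
  have hhJ : Measurable fun z => h (B • z) * ENNReal.ofReal (projJac M z) :=
    hhB.mul hJ.ennreal_ofReal
  rw [lintegral_map hhJ continuous_sphereMk.measurable,
    lintegral_map hh continuous_sphereMk.measurable]
  have hleft : ∫⁻ u, h (B • sphereMk u) * ENNReal.ofReal (projJac M (sphereMk u))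
      ∂(volume : Measure (Fin d → ℝ)).toSphere = ENNReal.ofReal (|M.det| * d) *
      ∫⁻ u, h (B • sphereMk u) * ENNReal.ofReal (‖M.mulVec u.1‖⁻¹ ^ d / d)
        ∂(volume : Measure (Fin d → ℝ)).toSphere := by
    rw [← lintegral_const_mul' _ _ ENNReal.ofReal_ne_top]
    refine lintegral_congr fun u => ?_
    have hu : ‖u.1‖ = 1 := mem_sphere_zero_iff_norm.1 u.2
    rw [mul_left_comm, ← ENNReal.ofReal_mul (by positivity)]
    congr 2
    rw [sphereMk, projJac_mk, hu, one_div]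
    field_simp
  refine hleft.trans ?_
  rw [← hBint, ← mul_assoc, ← ENNReal.ofReal_mul (by positivity),
    ← lintegral_const_mul' _ _ ENNReal.ofReal_ne_top]
  refine lintegral_congr fun u => ?_
  have hu : ‖u.1‖ = 1 := mem_sphere_zero_iff_norm.1 u.2
  rw [hu, mul_left_comm, ← ENNReal.ofReal_mul (by positivity)]
  have : |M.det| * d * |M.det⁻¹| * (1⁻¹ ^ d / d) = 1 := by
    rw [abs_inv]
    have := abs_pos.2 hdet
    field_simp
    simp
  rw [this, ENNReal.ofReal_one, mul_one]

end ReferenceMeasure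

/-! ### Operator norms and distortion -/

section OperatorNorm

variable {d : ℕ}

theorem opNorm_mul_le (B C : Matrix.GeneralLinearGroup (Fin d) ℝ) :
    opNorm (B * C) ≤ opNorm B * opNorm C := by
  rw [opNorm, Units.val_mul, map_mul]
  exact norm_mul_le _ _

theorem opNorm_one (hd : 1 ≤ d) : opNorm (1 : Matrix.GeneralLinearGroup (Fin d) ℝ) = 1 := by
  have : Nonempty (Fin d) := ⟨⟨0, hd⟩⟩
  rw [opNorm, Units.val_one, map_one, norm_one]

theorem one_le_opNorm_mul (hd : 1 ≤ d) (B : Matrix.GeneralLinearGroup (Fin d) ℝ) :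
    1 ≤ opNorm B * opNorm B⁻¹ := by
  rw [← opNorm_one hd, ← mul_inv_cancel B]
  exact opNorm_mul_le _ _

theorem opNorm_pos (hd : 1 ≤ d) (B : Matrix.GeneralLinearGroup (Fin d) ℝ) : 0 < opNorm B := by
  refine (norm_nonneg _).lt_of_ne fun h => ?_
  have h' : opNorm B = 0 := h.symm
  have := one_le_opNorm_mul hd B
  rw [h', zero_mul] at this
  exact absurd this (by norm_num)

theorem abs_entry_le_opNorm (B : Matrix.GeneralLinearGroup (Fin d) ℝ) (i j : Fin d) :
    |(B : Matrix (Fin d) (Fin d) ℝ) i j| ≤ opNorm B := by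
  have h1 := (Matrix.toEuclideanCLM (n := Fin d) (𝕜 := ℝ)
    (B : Matrix (Fin d) (Fin d) ℝ)).le_opNorm (EuclideanSpace.single j 1)
  have h2 := PiLp.norm_apply_le (Matrix.toEuclideanCLM (n := Fin d) (𝕜 := ℝ)
    (B : Matrix (Fin d) (Fin d) ℝ) (EuclideanSpace.single j 1)) i
  rw [PiLp.norm_single, norm_one, mul_one] at h1
  refine le_trans (le_of_eq ?_) (h2.trans h1)
  rw [Real.norm_eq_abs]
  congr 1
  have := congrFun (Matrix.ofLp_toEuclideanCLM (B : Matrix (Fin d) (Fin d) ℝ)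
    (EuclideanSpace.single j (1 : ℝ))) i
  rw [this]
  simp

theorem norm_mulVec_le_opNorm (B : Matrix.GeneralLinearGroup (Fin d) ℝ) (v : Fin d → ℝ) :
    ‖(B : Matrix (Fin d) (Fin d) ℝ).mulVec v‖ ≤ d * opNorm B * ‖v‖ := by
  have hB : 0 ≤ opNorm B := norm_nonneg _
  refine (pi_norm_le_iff_of_nonneg (by positivity)).2 fun i => ?_
  calc ‖(B : Matrix (Fin d) (Fin d) ℝ).mulVec v i‖
      ≤ ∑ j, ‖(B : Matrix (Fin d) (Fin d) ℝ) i j * v j‖ := by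
        rw [Matrix.mulVec, dotProduct]
        exact norm_sum_le _ _
    _ ≤ ∑ _j : Fin d, opNorm B * ‖v‖ := by
        refine Finset.sum_le_sum fun j _ => ?_
        rw [norm_mul]
        exact mul_le_mul (abs_entry_le_opNorm B i j) (norm_le_pi_norm v j) (norm_nonneg _) hB
    _ = d * opNorm B * ‖v‖ := by simp [mul_assoc]

theorem abs_det_le_opNorm (B : Matrix.GeneralLinearGroup (Fin d) ℝ) :
    |(B : Matrix (Fin d) (Fin d) ℝ).det| ≤ d.factorial * opNorm B ^ d := by
  have := Matrix.det_le (A := (B : Matrix (Fin d) (Fin d) ℝ)) (abv := AbsoluteValue.abs)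
    (x := opNorm B) (fun i j => abs_entry_le_opNorm B i j)
  simpa using this

theorem projJac_le (hd : 1 ≤ d) (B : Matrix.GeneralLinearGroup (Fin d) ℝ) (z : ProjSpace d) :
    projJac (B : Matrix (Fin d) (Fin d) ℝ) z ≤
      d.factorial * d ^ d * (opNorm B * opNorm B⁻¹) ^ d := by
  have hB := opNorm_pos hd B
  have hB' := opNorm_pos hd B⁻¹
  have h1 : ‖z.rep‖ / ‖(B : Matrix (Fin d) (Fin d) ℝ).mulVec z.rep‖ ≤ d * opNorm B⁻¹ := by
    rw [div_le_iff₀ (norm_pos_iff.2 (mulVec_ne_zero B z.rep_nonzero))]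
    have := norm_mulVec_le_opNorm B⁻¹ ((B : Matrix (Fin d) (Fin d) ℝ).mulVec z.rep)
    rwa [Matrix.mulVec_mulVec, ← Units.val_mul, inv_mul_cancel, Units.val_one,
      Matrix.one_mulVec] at this
  calc projJac (B : Matrix (Fin d) (Fin d) ℝ) z
      ≤ (d.factorial * opNorm B ^ d) * (d * opNorm B⁻¹) ^ d :=
        mul_le_mul (abs_det_le_opNorm B) (pow_le_pow_left₀ (by positivity) h1 _) (by positivity)
          (by positivity)
    _ = _ := by ring

/-- The distortion of volume by `B` on projective space is controlled by `‖B‖ ‖B⁻¹‖`. The lower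
bound of the Jacobian of `B` is the upper bound of that of `B⁻¹`. -/
theorem abs_log_projJac_le (hd : 1 ≤ d) (B : Matrix.GeneralLinearGroup (Fin d) ℝ)
    (z : ProjSpace d) :
    |Real.log (projJac (B : Matrix (Fin d) (Fin d) ℝ) z)| ≤
      Real.log (d.factorial * d ^ d) + d * (Real.log (opNorm B) + Real.log (opNorm B⁻¹)) := by
  have hd0 : (0 : ℝ) < d := by exact_mod_cast hd
  have hf : (0 : ℝ) < d.factorial := by exact_mod_cast d.factorial_pos
  have hup : ∀ (C : Matrix.GeneralLinearGroup (Fin d) ℝ) (w : ProjSpace d),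
      Real.log (projJac (C : Matrix (Fin d) (Fin d) ℝ) w) ≤
      Real.log (d.factorial * d ^ d) + d * (Real.log (opNorm C) + Real.log (opNorm C⁻¹)) := by
    intro C w
    have hC := opNorm_pos hd C
    have hC' := opNorm_pos hd C⁻¹
    have := Real.log_le_log (projJac_pos C w) (projJac_le hd C w)
    rwa [Real.log_mul (by positivity) (by positivity), Real.log_pow,
      Real.log_mul hC.ne' hC'.ne'] at this
  refine abs_le'.2 ⟨hup B z, ?_⟩
  have h1 := projJac_mul B⁻¹ B z
  rw [inv_mul_cancel, projJac_one] at h1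
  have h2 := hup B⁻¹ (B • z)
  rw [inv_inv, add_comm (Real.log (opNorm B⁻¹))] at h2
  refine le_trans (le_of_eq ?_) h2
  rw [← Real.log_inv]
  congr 1
  exact inv_eq_of_mul_eq_one_left h1.symm

theorem MeasurableGL.measurable_opNorm {α : Type*} [MeasurableSpace α]
    {A : α → Matrix.GeneralLinearGroup (Fin d) ℝ} (hA : MeasurableGL A) :
    Measurable fun a => opNorm (A a) := by
  have hc : Continuous fun M : Fin d → Fin d → ℝ =>
      Matrix.toEuclideanCLM (n := Fin d) (𝕜 := ℝ) (Matrix.of M) := by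
    let L : (Fin d → Fin d → ℝ) →ₗ[ℝ] (EuclideanSpace ℝ (Fin d) →L[ℝ] EuclideanSpace ℝ (Fin d)) :=
      { toFun := fun M => Matrix.toEuclideanCLM (n := Fin d) (𝕜 := ℝ) (Matrix.of M)
        map_add' := fun M N => map_add _ (Matrix.of M) (Matrix.of N)
        map_smul' := fun c M => map_smul _ c (Matrix.of M) }
    exact L.continuous_of_finiteDimensional
  exact hc.norm.measurable.comp hA.measurable_entries

theorem MeasurableGL.mul {α : Type*} [MeasurableSpace α]
    {A B : α → Matrix.GeneralLinearGroup (Fin d) ℝ} (hA : MeasurableGL A) (hB : MeasurableGL B) :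
    MeasurableGL fun a => A a * B a := by
  intro i j
  simp only [Units.val_mul, Matrix.mul_apply]
  exact Finset.measurable_sum _ fun k _ => (hA i k).mul (hB k j)

theorem MeasurableGL.inv {α : Type*} [MeasurableSpace α]
    {A : α → Matrix.GeneralLinearGroup (Fin d) ℝ} (hA : MeasurableGL A) :
    MeasurableGL fun a => (A a)⁻¹ := by
  intro i j
  have hdet : ∀ C : α → Fin d → Fin d → ℝ, Measurable C →
      Measurable fun a => (Matrix.of (C a)).det := by
    intro C hC
    simp only [Matrix.det_apply, Matrix.of_apply]
    fun_prop
  simp only [Matrix.coe_units_inv, Matrix.inv_def, Matrix.smul_apply, smul_eq_mul,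
    Ring.inverse_eq_inv', Matrix.adjugate_apply]
  refine (hdet _ hA.measurable_entries).inv.mul (hdet
    (fun a => (A a : Matrix (Fin d) (Fin d) ℝ).updateRow j (Pi.single i 1)) ?_)
  refine measurable_pi_lambda _ fun k => measurable_pi_lambda _ fun l => ?_
  simp only [Matrix.updateRow_apply]
  split_ifs
  · exact measurable_const
  · exact hA k l

end OperatorNorm

/-! ### Densities along a random orbit -/

section Entropy

variable {S Y W : Type*} [MeasurableSpace S] [MeasurableSpace Y] [MeasurableSpace W]

/-- A random map `F i : S → S`, `i` of law `p`, almost all of whose samples distort the measure `Λ`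
by the positive Jacobian `J i`: the map `F i` takes the measure `J i • Λ` to `Λ`. -/
structure HasJacobian (p : Measure Y) (Λ : Measure S) (F : Y × S → S) (J : Y × S → ℝ) : Prop where
  measurable_map : Measurable F
  measurable_jac : Measurable J
  pos : ∀ x, 0 < J x
  change : ∀ᵐ i ∂p, MeasurePreserving (fun s => F (i, s))
    (Λ.withDensity fun s => ENNReal.ofReal (J (i, s))) Λ

/-- The Markov operator of the random map `F`: the law of `F i s` for independent `i` of law `p` and
`s` of law `ν`. -/
noncomputable def transport (p : Measure Y) (F : Y × S → S) (ν : Measure S) : Measure S :=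
  (p.prod ν).map F

theorem isProbabilityMeasure_transport (p : Measure Y) [IsProbabilityMeasure p] {F : Y × S → S}
    (hF : Measurable F) (ν : Measure S) [IsProbabilityMeasure ν] :
    IsProbabilityMeasure (transport p F ν) :=
  Measure.isProbabilityMeasure_map hF.aemeasurable

/-- The real-valued density of `ν` with respect to `Λ`. -/
noncomputable def density (Λ ν : Measure S) (s : S) : ℝ := (ν.rnDeriv Λ s).toReal

theorem density_nonneg (Λ ν : Measure S) (s : S) : 0 ≤ density Λ ν s := ENNReal.toReal_nonneg

theorem measurable_density (Λ ν : Measure S) : Measurable (density Λ ν) :=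
  (Measure.measurable_rnDeriv ν Λ).ennreal_toReal

variable {p : Measure Y} {Λ ν ν' : Measure S} {F : Y × S → S} {J : Y × S → ℝ}

namespace HasJacobian

theorem lintegral_change [SFinite Λ] (h : HasJacobian p Λ F J) :
    ∀ᵐ i ∂p, ∀ g : S → ENNReal, Measurable g →
      ∫⁻ s, g (F (i, s)) * ENNReal.ofReal (J (i, s)) ∂Λ = ∫⁻ s, g s ∂Λ := by
  filter_upwards [h.change] with i hi g hg
  have hJi : Measurable fun s => ENNReal.ofReal (J (i, s)) :=
    (h.measurable_jac.comp measurable_prodMk_left).ennreal_ofReal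
  have hgi : Measurable fun s => g (F (i, s)) :=
    hg.comp (h.measurable_map.comp measurable_prodMk_left)
  rw [← hi.lintegral_comp hg, lintegral_withDensity_eq_lintegral_mul _ hJi hgi]
  exact lintegral_congr fun s => mul_comm _ _

theorem lintegral_prod_change [IsProbabilityMeasure p] [SFinite Λ] (h : HasJacobian p Λ F J)
    {g : S → ENNReal} (hg : Measurable g) :
    ∫⁻ x, g (F x) * ENNReal.ofReal (J x) ∂(p.prod Λ) = ∫⁻ s, g s ∂Λ := by
  have hm : Measurable fun x => g (F x) * ENNReal.ofReal (J x) :=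
    (hg.comp h.measurable_map).mul h.measurable_jac.ennreal_ofReal
  rw [lintegral_prod _ hm.aemeasurable]
  have : ∀ᵐ i ∂p, ∫⁻ s, g (F (i, s)) * ENNReal.ofReal (J (i, s)) ∂Λ = ∫⁻ s, g s ∂Λ := by
    filter_upwards [h.lintegral_change] with i hi using hi g hg
  rw [lintegral_congr_ae this, lintegral_const, measure_univ, mul_one]

theorem transport_absolutelyContinuous [IsProbabilityMeasure p] [SFinite Λ] [SFinite ν]
    (h : HasJacobian p Λ F J) (hν : ν ≪ Λ) : transport p F ν ≪ Λ := by
  refine Measure.AbsolutelyContinuous.mk fun B hB hB0 => ?_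
  have hm : Measurable fun x => B.indicator (1 : S → ENNReal) (F x) * ENNReal.ofReal (J x) :=
    ((measurable_one.indicator hB).comp h.measurable_map).mul h.measurable_jac.ennreal_ofReal
  have h1 := h.lintegral_prod_change (measurable_one.indicator hB : Measurable (B.indicator 1))
  rw [lintegral_indicator_one hB, hB0, lintegral_eq_zero_iff hm] at h1
  have h2 : (p.prod Λ) (F ⁻¹' B) = 0 := by
    refine measure_mono_null (fun x hx => ?_) (ae_iff.1 h1)
    have hx' : F x ∈ B := hx
    simpa [hx'] using h.pos x
  rw [transport, Measure.map_apply h.measurable_map hB]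
  exact (Measure.AbsolutelyContinuous.rfl.prod hν) h2

end HasJacobian

/-- An elementary form of the comparison between total variation and Hellinger distance. -/
theorem abs_sub_le_hellinger {a b δ : ℝ} (ha : 0 ≤ a) (hb : 0 ≤ b) (hδ : 0 < δ) :
    |a - b| ≤ 1 / (2 * δ) * (a + b - 2 * √(a * b)) + δ * (a + b) := by
  obtain ⟨x, hx, rfl⟩ : ∃ x : ℝ, 0 ≤ x ∧ a = x ^ 2 :=
    ⟨√a, Real.sqrt_nonneg a, (Real.sq_sqrt ha).symm⟩
  obtain ⟨y, hy, rfl⟩ : ∃ y : ℝ, 0 ≤ y ∧ b = y ^ 2 :=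
    ⟨√b, Real.sqrt_nonneg b, (Real.sq_sqrt hb).symm⟩
  rw [← mul_pow, Real.sqrt_sq (mul_nonneg hx hy)]
  have h1 : |x ^ 2 - y ^ 2| = |x - y| * (x + y) := by
    rw [show x ^ 2 - y ^ 2 = (x - y) * (x + y) by ring, abs_mul, abs_of_nonneg (add_nonneg hx hy)]
  have h2 : 1 / (2 * δ) * (x ^ 2 + y ^ 2 - 2 * (x * y)) = |x - y| ^ 2 / (2 * δ) := by
    rw [sq_abs]; ring
  rw [h1, h2]
  have h3 : 0 ≤ (|x - y| - δ * (x + y)) ^ 2 / (2 * δ) := by positivity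
  have h4 : (|x - y| - δ * (x + y)) ^ 2 / (2 * δ) =
      |x - y| ^ 2 / (2 * δ) - |x - y| * (x + y) + δ / 2 * (x + y) ^ 2 := by
    field_simp; ring
  nlinarith [mul_nonneg hδ.le (sq_nonneg (x - y))]

theorem mul_sqrt_div {a b : ℝ} (ha : 0 ≤ a) : a * √(b / a) = √(a * b) := by
  rcases ha.eq_or_lt with rfl | ha'
  · simp
  · rw [show a * b = a ^ 2 * (b / a) by field_simp, Real.sqrt_mul (sq_nonneg a), Real.sqrt_sq ha]

/-- The square root of the ratio between the density of `ν'` transported back by `F` and the density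
of `ν`. It is `0` where the latter vanishes, which is a null set for `ν`. -/
noncomputable def sqrtRatio (Λ ν ν' : Measure S) (F : Y × S → S) (J : Y × S → ℝ) (x : Y × S) : ℝ :=
  √(density Λ ν' (F x) * J x / density Λ ν x.2)

/-- The density of `ν` minus the density of `ν'` transported back by `F`. -/
noncomputable def densityGap (Λ ν ν' : Measure S) (F : Y × S → S) (J : Y × S → ℝ) (x : Y × S) :
    ℝ :=
  density Λ ν x.2 - density Λ ν' (F x) * J x

theorem integrable_density [IsFiniteMeasure ν] : Integrable (density Λ ν) Λ :=
  Measure.integrable_toReal_rnDeriv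

theorem integrable_density_snd [IsProbabilityMeasure p] [SFinite Λ] [IsFiniteMeasure ν] :
    Integrable (fun x : Y × S => density Λ ν x.2) (p.prod Λ) :=
  integrable_density.comp_snd p

theorem integral_density [IsProbabilityMeasure Λ] [IsProbabilityMeasure ν] (hν : ν ≪ Λ) :
    ∫ s, density Λ ν s ∂Λ = 1 := by
  simp [density, Measure.integral_toReal_rnDeriv hν]

theorem integral_density_snd [IsProbabilityMeasure p] [IsProbabilityMeasure Λ]
    [IsProbabilityMeasure ν] (hν : ν ≪ Λ) :
    ∫ x : Y × S, density Λ ν x.2 ∂(p.prod Λ) = 1 := by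
  rw [integral_fun_snd (fun s => density Λ ν s), integral_density hν]
  simp

theorem HasJacobian.lintegral_density_comp [IsProbabilityMeasure p] [IsProbabilityMeasure Λ]
    [IsProbabilityMeasure ν'] (h : HasJacobian p Λ F J) (hν' : ν' ≪ Λ) :
    ∫⁻ x, ENNReal.ofReal (density Λ ν' (F x) * J x) ∂(p.prod Λ) = 1 := by
  have h1 := h.lintegral_prod_change (measurable_density Λ ν').ennreal_ofReal
  rw [← ofReal_integral_eq_lintegral_ofReal integrable_density (ae_of_all _ (density_nonneg Λ ν')),
    integral_density hν', ENNReal.ofReal_one] at h1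
  simpa only [← ENNReal.ofReal_mul (density_nonneg Λ ν' _)] using h1

theorem HasJacobian.integrable_density_comp [IsProbabilityMeasure p] [IsProbabilityMeasure Λ]
    [IsProbabilityMeasure ν'] (h : HasJacobian p Λ F J) (hν' : ν' ≪ Λ) :
    Integrable (fun x => density Λ ν' (F x) * J x) (p.prod Λ) := by
  have hm : Measurable fun x => density Λ ν' (F x) * J x :=
    ((measurable_density Λ ν').comp h.measurable_map).mul h.measurable_jac
  refine ⟨hm.aestronglyMeasurable, ?_⟩
  rw [hasFiniteIntegral_iff_ofReal
    (ae_of_all _ fun x => mul_nonneg (density_nonneg _ _ _) (h.pos x).le),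
    h.lintegral_density_comp hν']
  exact ENNReal.one_lt_top

theorem HasJacobian.integral_density_comp [IsProbabilityMeasure p] [IsProbabilityMeasure Λ]
    [IsProbabilityMeasure ν'] (h : HasJacobian p Λ F J) (hν' : ν' ≪ Λ) :
    ∫ x, density Λ ν' (F x) * J x ∂(p.prod Λ) = 1 := by
  rw [integral_eq_lintegral_of_nonneg_ae
    (ae_of_all _ fun x => mul_nonneg (density_nonneg _ _ _) (h.pos x).le)
    (h.integrable_density_comp hν').aestronglyMeasurable, h.lintegral_density_comp hν',
    ENNReal.toReal_one]

theorem prod_eq_withDensity [IsProbabilityMeasure Λ] [IsProbabilityMeasure ν] (hν : ν ≪ Λ) :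
    p.prod ν = (p.prod Λ).withDensity fun x => ν.rnDeriv Λ x.2 := by
  conv_lhs => rw [← Measure.withDensity_rnDeriv_eq ν Λ hν]
  exact prod_withDensity_right (Measure.measurable_rnDeriv ν Λ)

theorem ae_rnDeriv_snd_lt_top [SFinite Λ] [IsProbabilityMeasure ν] :
    ∀ᵐ x ∂(p.prod Λ), ν.rnDeriv Λ x.2 < ⊤ :=
  Measure.quasiMeasurePreserving_snd.ae (Measure.rnDeriv_lt_top ν Λ)

theorem measurable_rnDeriv_snd : Measurable fun x : Y × S => ν.rnDeriv Λ x.2 :=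
  (Measure.measurable_rnDeriv ν Λ).comp measurable_snd

theorem density_mul_sqrtRatio {Y : Type*} {F : Y × S → S} {J : Y × S → ℝ} (x : Y × S) :
    (ν.rnDeriv Λ x.2).toReal • sqrtRatio Λ ν ν' F J x =
      √(density Λ ν x.2 * (density Λ ν' (F x) * J x)) :=
  mul_sqrt_div (density_nonneg Λ ν x.2)

theorem HasJacobian.measurable_sqrtRatio (h : HasJacobian p Λ F J) :
    Measurable (sqrtRatio Λ ν ν' F J) :=
  ((((measurable_density Λ ν').comp h.measurable_map).mul h.measurable_jac).div
    ((measurable_density Λ ν).comp measurable_snd)).sqrt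

theorem HasJacobian.integrable_sqrt_mul [IsProbabilityMeasure p] [IsProbabilityMeasure Λ]
    [IsProbabilityMeasure ν] [IsProbabilityMeasure ν'] (h : HasJacobian p Λ F J) (hν' : ν' ≪ Λ) :
    Integrable (fun x => √(density Λ ν x.2 * (density Λ ν' (F x) * J x))) (p.prod Λ) := by
  refine ((integrable_density_snd (ν := ν)).add (h.integrable_density_comp hν')).mono'
    (Measurable.aestronglyMeasurable ?_) (ae_of_all _ fun x => ?_)
  · exact (((measurable_density Λ ν).comp measurable_snd).mul
      (((measurable_density Λ ν').comp h.measurable_map).mul h.measurable_jac)).sqrt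
  · have ha := density_nonneg Λ ν x.2
    have hb := mul_nonneg (density_nonneg Λ ν' (F x)) (h.pos x).le
    rw [Real.norm_of_nonneg (Real.sqrt_nonneg _), Pi.add_apply]
    refine Real.sqrt_le_iff.2 ⟨add_nonneg ha hb, ?_⟩
    nlinarith

theorem HasJacobian.integrable_sqrtRatio [IsProbabilityMeasure p] [IsProbabilityMeasure Λ]
    [IsProbabilityMeasure ν] [IsProbabilityMeasure ν'] (h : HasJacobian p Λ F J) (hν : ν ≪ Λ)
    (hν' : ν' ≪ Λ) : Integrable (sqrtRatio Λ ν ν' F J) (p.prod ν) := by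
  rw [prod_eq_withDensity hν,
    integrable_withDensity_iff_integrable_smul' measurable_rnDeriv_snd ae_rnDeriv_snd_lt_top]
  simp only [density_mul_sqrtRatio]
  exact h.integrable_sqrt_mul hν'

theorem integral_sqrtRatio [IsProbabilityMeasure Λ] [IsProbabilityMeasure ν] (hν : ν ≪ Λ) :
    ∫ x, sqrtRatio Λ ν ν' F J x ∂(p.prod ν) =
      ∫ x, √(density Λ ν x.2 * (density Λ ν' (F x) * J x)) ∂(p.prod Λ) := by
  rw [prod_eq_withDensity hν,
    integral_withDensity_eq_integral_toReal_smul measurable_rnDeriv_snd ae_rnDeriv_snd_lt_top]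
  simp only [density_mul_sqrtRatio]

theorem HasJacobian.integrable_densityGap [IsProbabilityMeasure p] [IsProbabilityMeasure Λ]
    [IsProbabilityMeasure ν] [IsProbabilityMeasure ν'] (h : HasJacobian p Λ F J) (hν' : ν' ≪ Λ) :
    Integrable (densityGap Λ ν ν' F J) (p.prod Λ) :=
  integrable_density_snd.sub (h.integrable_density_comp hν')

/-- The total variation between the density of `ν` and that of `ν'` transported back by `F` is small
when the mean of the square root of their ratio is close to `1`. -/
theorem HasJacobian.integral_abs_densityGap_le [IsProbabilityMeasure p] [IsProbabilityMeasure Λ]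
    [IsProbabilityMeasure ν] [IsProbabilityMeasure ν'] (h : HasJacobian p Λ F J) (hν : ν ≪ Λ)
    (hν' : ν' ≪ Λ) {δ : ℝ} (hδ : 0 < δ) :
    ∫ x, |densityGap Λ ν ν' F J x| ∂(p.prod Λ) ≤
      1 / δ * (1 - ∫ x, sqrtRatio Λ ν ν' F J x ∂(p.prod ν)) + 2 * δ := by
  have ha := integrable_density_snd (p := p) (Λ := Λ) (ν := ν)
  have hb := h.integrable_density_comp (ν' := ν') hν'
  have hs := h.integrable_sqrt_mul (ν := ν) hν'
  have hab : Integrable (fun x => density Λ ν x.2 + density Λ ν' (F x) * J x) (p.prod Λ) :=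
    ha.add hb
  have hsub : Integrable (fun x => density Λ ν x.2 + density Λ ν' (F x) * J x
      - 2 * √(density Λ ν x.2 * (density Λ ν' (F x) * J x))) (p.prod Λ) :=
    hab.sub (hs.const_mul 2)
  have hle : ∫ x, |densityGap Λ ν ν' F J x| ∂(p.prod Λ) ≤
      ∫ x, (1 / (2 * δ) * (density Λ ν x.2 + density Λ ν' (F x) * J x
        - 2 * √(density Λ ν x.2 * (density Λ ν' (F x) * J x)))
        + δ * (density Λ ν x.2 + density Λ ν' (F x) * J x)) ∂(p.prod Λ) := by
    refine integral_mono (h.integrable_densityGap hν').abs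
      ((hsub.const_mul _).add (hab.const_mul _)) fun x => ?_
    exact abs_sub_le_hellinger (density_nonneg _ _ _)
      (mul_nonneg (density_nonneg _ _ _) (h.pos x).le) hδ
  refine hle.trans (le_of_eq ?_)
  rw [integral_add (hsub.const_mul _) (hab.const_mul _), integral_const_mul, integral_const_mul,
    integral_sub hab (hs.const_mul 2), integral_const_mul, ← integral_sqrtRatio hν,
    integral_add ha hb, integral_density_snd hν, h.integral_density_comp hν']
  field_simp
  ring

/-- Testing against bounded functions: `ν'` and the image of `ν` under `F i` are close in mean over
`i` when the density gap is small. -/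
theorem HasJacobian.integral_abs_integral_sub_le [IsProbabilityMeasure p] [IsProbabilityMeasure Λ]
    [IsProbabilityMeasure ν] [IsProbabilityMeasure ν'] (h : HasJacobian p Λ F J) (hν : ν ≪ Λ)
    (hν' : ν' ≪ Λ) {g : S → ℝ} (hg : Measurable g) {C : ℝ} (hC : ∀ s, |g s| ≤ C) :
    ∫ i, |∫ s, g (F (i, s)) ∂ν - ∫ s, g s ∂ν'| ∂p ≤
      C * ∫ x, |densityGap Λ ν ν' F J x| ∂(p.prod Λ) := by
  have hgap := (h.integrable_densityGap (ν := ν) hν').abs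
  rw [integral_prod _ hgap, ← integral_const_mul]
  refine integral_mono_of_nonneg (ae_of_all _ fun i => abs_nonneg _)
    (hgap.integral_prod_left.const_mul C) ?_
  filter_upwards [h.change, hgap.prod_right_ae,
    (integrable_density_snd (p := p) (Λ := Λ) (ν := ν)).prod_right_ae,
    (h.integrable_density_comp (ν' := ν') hν').prod_right_ae] with i hi hgi hai hbi
  have hbdd : ∀ s, ‖g (F (i, s))‖ ≤ C := fun s => hC _
  have hgF : Measurable fun s => g (F (i, s)) :=
    hg.comp (h.measurable_map.comp measurable_prodMk_left)
  have e1 : ∫ s, g (F (i, s)) ∂ν = ∫ s, g (F (i, s)) * density Λ ν s ∂Λ := by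
    rw [← integral_rnDeriv_smul hν]
    exact integral_congr_ae (ae_of_all _ fun s => mul_comm _ _)
  have e2 : ∫ s, g s ∂ν' = ∫ s, g (F (i, s)) * (density Λ ν' (F (i, s)) * J (i, s)) ∂Λ := by
    have hJi : Measurable fun s => ENNReal.ofReal (J (i, s)) :=
      (h.measurable_jac.comp measurable_prodMk_left).ennreal_ofReal
    have hψg : Measurable fun s => density Λ ν' s * g s := (measurable_density Λ ν').mul hg
    calc ∫ s, g s ∂ν' = ∫ s, density Λ ν' s * g s ∂Λ := (integral_rnDeriv_smul hν').symm
      _ = ∫ s, density Λ ν' s * g s ∂((Λ.withDensity fun s => ENNReal.ofReal (J (i, s))).map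
            fun s => F (i, s)) := by rw [hi.map_eq]
      _ = ∫ s, density Λ ν' (F (i, s)) * g (F (i, s))
            ∂(Λ.withDensity fun s => ENNReal.ofReal (J (i, s))) :=
          integral_map hi.measurable.aemeasurable hψg.aestronglyMeasurable
      _ = _ := by
          rw [integral_withDensity_eq_integral_toReal_smul hJi
            (ae_of_all _ fun s => ENNReal.ofReal_lt_top)]
          refine integral_congr_ae (ae_of_all _ fun s => ?_)
          simp only [smul_eq_mul, ENNReal.toReal_ofReal (h.pos (i, s)).le]
          ring
  rw [e1, e2, ← integral_sub (hai.bdd_mul hgF.aestronglyMeasurable (ae_of_all _ hbdd))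
    (hbi.bdd_mul hgF.aestronglyMeasurable (ae_of_all _ hbdd)), ← integral_const_mul]
  refine (abs_integral_le_integral_abs).trans (integral_mono_of_nonneg
    (ae_of_all _ fun s => abs_nonneg _) (hgi.const_mul C) (ae_of_all _ fun s => ?_))
  simp only [← mul_sub, abs_mul]
  exact mul_le_mul_of_nonneg_right (hC _) (abs_nonneg _)

/-- The successive images of `Λ` under the Markov operator of `F`. -/
noncomputable def transportIter (p : Measure Y) (F : Y × S → S) (Λ : Measure S) : ℕ → Measure S
  | 0 => Λ
  | n + 1 => transport p F (transportIter p F Λ n)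

theorem isProbabilityMeasure_transportIter [IsProbabilityMeasure p] [IsProbabilityMeasure Λ]
    (hF : Measurable F) (n : ℕ) : IsProbabilityMeasure (transportIter p F Λ n) := by
  induction n with
  | zero => assumption
  | succ n ih => exact isProbabilityMeasure_transport p hF _

/-- Since the Jacobians do not vanish, the laws of the random orbit keep having densities. -/
theorem HasJacobian.transportIter_absolutelyContinuous [IsProbabilityMeasure p]
    [IsProbabilityMeasure Λ] (h : HasJacobian p Λ F J) (n : ℕ) : transportIter p F Λ n ≪ Λ := by
  induction n with
  | zero => exact Measure.AbsolutelyContinuous.rfl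
  | succ n ih =>
    have := isProbabilityMeasure_transportIter (p := p) (Λ := Λ) h.measurable_map n
    exact h.transport_absolutelyContinuous ih

/-- The integral is the `Λ`-measure of the set where the density does not vanish. -/
theorem lintegral_inv_density_le [IsProbabilityMeasure Λ] [IsProbabilityMeasure ν] (hν : ν ≪ Λ) :
    ∫⁻ s, ENNReal.ofReal (density Λ ν s)⁻¹ ∂ν ≤ 1 := by
  have hm : Measurable fun s => ENNReal.ofReal (density Λ ν s)⁻¹ :=
    (measurable_density Λ ν).inv.ennreal_ofReal
  rw [← lintegral_rnDeriv_mul hν hm.aemeasurable, ← measure_univ (μ := Λ), ← lintegral_one]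
  refine lintegral_mono_ae ?_
  filter_upwards [Measure.rnDeriv_lt_top ν Λ] with s hs
  rw [← ENNReal.ofReal_toReal hs.ne, ← ENNReal.ofReal_mul ENNReal.toReal_nonneg,
    ← ENNReal.ofReal_one]
  exact ENNReal.ofReal_le_ofReal mul_inv_le_one

theorem ae_density_pos [IsProbabilityMeasure Λ] [IsProbabilityMeasure ν] (hν : ν ≪ Λ) :
    ∀ᵐ s ∂ν, 0 < density Λ ν s := by
  filter_upwards [Measure.rnDeriv_pos hν, hν.ae_le (Measure.rnDeriv_lt_top ν Λ)] with s h1 h2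
  exact ENNReal.toReal_pos h1.ne' h2.ne

/-- The total loss of the square roots of density ratios along a random orbit is bounded in terms of
the distortion of `Λ` by the composed map alone. By `1 - r ≤ -log r`, the sum telescopes to the
logarithm of the final density, the initial density being `1`, and to the sum of the logarithms of
the Jacobians. -/
theorem HasJacobian.sum_one_sub_integral_sqrtRatio_le [IsProbabilityMeasure p]
    [IsProbabilityMeasure Λ] (h : HasJacobian p Λ F J) {M : Measure W} [IsProbabilityMeasure M]
    {i : ℕ → W → Y} {q : ℕ → W → S}
    (hlaw : ∀ n, MeasurePreserving (fun w => (i n w, q n w)) M (p.prod (transportIter p F Λ n)))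
    (hq : ∀ n w, q (n + 1) w = F (i n w, q n w)) (N : ℕ)
    (hint : Integrable (fun w => ∑ n ∈ Finset.range N, Real.log (J (i n w, q n w))) M) :
    ∑ n ∈ Finset.range N, (1 - ∫ x, sqrtRatio Λ (transportIter p F Λ n)
        (transportIter p F Λ (n + 1)) F J x ∂(p.prod (transportIter p F Λ n))) ≤
      1 / 2 * (1 + ∫ w, |∑ n ∈ Finset.range N, Real.log (J (i n w, q n w))| ∂M) := by
  have hprob := isProbabilityMeasure_transportIter (p := p) (Λ := Λ) h.measurable_map
  have hac := h.transportIter_absolutelyContinuous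
  set η := transportIter p F Λ with hη
  let r : ℕ → W → ℝ := fun n w => sqrtRatio Λ (η n) (η (n + 1)) F J (i n w, q n w)
  have hqlaw : ∀ n, MeasurePreserving (q n) M (η n) := fun n =>
    (measurePreserving_snd (μ := p)).comp (hlaw n)
  have hr1 : ∀ n, Integrable (r n) M := fun n =>
    (hlaw n).integrable_comp_of_integrable (h.integrable_sqrtRatio (hac n) (hac (n + 1)))
  have hrint : ∀ n, Integrable (fun w => 1 - r n w) M := fun n =>
    (integrable_const (1 : ℝ)).sub (hr1 n)
  have hreq : ∀ n, ∫ w, r n w ∂M = ∫ x, sqrtRatio Λ (η n) (η (n + 1)) F J x ∂(p.prod (η n)) := by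
    intro n
    rw [← (hlaw n).map_eq, integral_map (hlaw n).measurable.aemeasurable]
    exact h.measurable_sqrtRatio.aestronglyMeasurable
  -- The inverse of the final density is integrable along the orbit, with integral at most one.
  have hinv_nonneg : ∀ w, 0 ≤ (density Λ (η N) (q N w))⁻¹ := fun w =>
    inv_nonneg.2 (density_nonneg _ _ _)
  have hinv_meas : Measurable fun w => (density Λ (η N) (q N w))⁻¹ :=
    ((measurable_density Λ (η N)).comp (hqlaw N).measurable).inv
  have hinv_lint : ∫⁻ w, ENNReal.ofReal (density Λ (η N) (q N w))⁻¹ ∂M ≤ 1 := by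
    refine le_trans (le_of_eq ?_) (lintegral_inv_density_le (hac N))
    exact (hqlaw N).lintegral_comp (measurable_density Λ (η N)).inv.ennreal_ofReal
  have hinv_int : Integrable (fun w => (density Λ (η N) (q N w))⁻¹) M := by
    refine ⟨hinv_meas.aestronglyMeasurable, ?_⟩
    rw [hasFiniteIntegral_iff_ofReal (ae_of_all _ hinv_nonneg)]
    exact hinv_lint.trans_lt ENNReal.one_lt_top
  have hinv_le : ∫ w, (density Λ (η N) (q N w))⁻¹ ∂M ≤ 1 := by
    rw [integral_eq_lintegral_of_nonneg_ae (ae_of_all _ hinv_nonneg)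
      hinv_meas.aestronglyMeasurable]
    exact ENNReal.toReal_le_of_le_ofReal zero_le_one (by simpa using hinv_lint)
  have hpos : ∀ᵐ w ∂M, ∀ n, 0 < density Λ (η n) (q n w) :=
    ae_all_iff.2 fun n => (hqlaw n).quasiMeasurePreserving.ae (ae_density_pos (hac n))
  have hone : ∀ᵐ w ∂M, density Λ (η 0) (q 0 w) = 1 := by
    refine (hqlaw 0).quasiMeasurePreserving.ae (p := fun s => density Λ (η 0) s = 1) ?_
    change ∀ᵐ s ∂Λ, density Λ Λ s = 1
    filter_upwards [Measure.rnDeriv_self Λ] with s hs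
    simp [density, hs]
  have hpt : ∀ᵐ w ∂M, ∑ n ∈ Finset.range N, (1 - r n w) ≤
      1 / 2 * ((density Λ (η N) (q N w))⁻¹
        + |∑ n ∈ Finset.range N, Real.log (J (i n w, q n w))|) := by
    filter_upwards [hpos, hone] with w hw hw1
    have hstep : ∀ n, 1 - r n w ≤ 1 / 2 * ((Real.log (density Λ (η n) (q n w))
        - Real.log (density Λ (η (n + 1)) (q (n + 1) w))) - Real.log (J (i n w, q n w))) := by
      intro n
      have hR : 0 < density Λ (η (n + 1)) (F (i n w, q n w)) * J (i n w, q n w) /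
          density Λ (η n) (q n w) := by
        rw [← hq n w]
        exact div_pos (mul_pos (hw (n + 1)) (h.pos _)) (hw n)
      have hlog : Real.log (r n w) = 1 / 2 * (Real.log (density Λ (η (n + 1)) (q (n + 1) w))
          + Real.log (J (i n w, q n w)) - Real.log (density Λ (η n) (q n w))) := by
        simp only [r, sqrtRatio]
        rw [Real.log_sqrt hR.le, ← hq n w, Real.log_div (mul_pos (hw (n + 1)) (h.pos _)).ne'
          (hw n).ne', Real.log_mul (hw (n + 1)).ne' (h.pos _).ne']
        ring
      have := Real.log_le_sub_one_of_pos (show 0 < r n w from Real.sqrt_pos.2 hR)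
      rw [hlog] at this
      linarith
    refine (Finset.sum_le_sum fun n _ => hstep n).trans ?_
    rw [← Finset.mul_sum, Finset.sum_sub_distrib,
      Finset.sum_range_sub' (fun n => Real.log (density Λ (η n) (q n w))), hw1, Real.log_one]
    refine mul_le_mul_of_nonneg_left ?_ (by norm_num)
    have h1 := Real.log_le_sub_one_of_pos (inv_pos.2 (hw N))
    rw [Real.log_inv] at h1
    have h2 := neg_abs_le (∑ n ∈ Finset.range N, Real.log (J (i n w, q n w)))
    linarith
  have hmono := integral_mono_ae
    (integrable_finsetSum _ fun n _ => hrint n)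
    ((hinv_int.add hint.abs).const_mul (1 / 2)) hpt
  have hl : ∫ w, ∑ n ∈ Finset.range N, (1 - r n w) ∂M = ∑ n ∈ Finset.range N,
      (1 - ∫ x, sqrtRatio Λ (η n) (η (n + 1)) F J x ∂(p.prod (η n))) := by
    rw [integral_finsetSum _ fun n _ => hrint n]
    refine Finset.sum_congr rfl fun n _ => ?_
    rw [integral_sub (integrable_const _) (hr1 n), hreq]
    simp
  have hr : ∫ w, 1 / 2 * ((density Λ (η N) (q N w))⁻¹
        + |∑ n ∈ Finset.range N, Real.log (J (i n w, q n w))|) ∂M =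
      1 / 2 * (∫ w, (density Λ (η N) (q N w))⁻¹ ∂M
        + ∫ w, |∑ n ∈ Finset.range N, Real.log (J (i n w, q n w))| ∂M) := by
    rw [integral_const_mul, integral_add hinv_int hint.abs]
  rw [← hl]
  refine (hmono.trans (le_of_eq hr)).trans ?_
  linarith

/-- For a bounded function `g`, the successive laws of a random orbit fail to be transported into
one another by the individual maps `F i` by an amount whose sum up to time `N` is controlled by the
distortion of `Λ` under the composition of `N` maps. -/
theorem HasJacobian.sum_integral_abs_integral_sub_le [IsProbabilityMeasure p]
    [IsProbabilityMeasure Λ] (h : HasJacobian p Λ F J) {M : Measure W} [IsProbabilityMeasure M]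
    {i : ℕ → W → Y} {q : ℕ → W → S}
    (hlaw : ∀ n, MeasurePreserving (fun w => (i n w, q n w)) M (p.prod (transportIter p F Λ n)))
    (hq : ∀ n w, q (n + 1) w = F (i n w, q n w)) (N : ℕ)
    (hint : Integrable (fun w => ∑ n ∈ Finset.range N, Real.log (J (i n w, q n w))) M)
    {g : S → ℝ} (hg : Measurable g) {C : ℝ} (hC : ∀ s, |g s| ≤ C) {δ : ℝ} (hδ : 0 < δ) :
    ∑ n ∈ Finset.range N, ∫ y, |∫ s, g (F (y, s)) ∂(transportIter p F Λ n)
        - ∫ s, g s ∂(transportIter p F Λ (n + 1))| ∂p ≤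
      C * (1 / (2 * δ) * (1 + ∫ w, |∑ n ∈ Finset.range N, Real.log (J (i n w, q n w))| ∂M)
        + 2 * δ * N) := by
  have hprob := isProbabilityMeasure_transportIter (p := p) (Λ := Λ) h.measurable_map
  have hac := h.transportIter_absolutelyContinuous
  obtain ⟨s₀⟩ : Nonempty S := Λ.nonempty_of_neZero
  have hC0 : 0 ≤ C := (abs_nonneg _).trans (hC s₀)
  have h1 := h.sum_one_sub_integral_sqrtRatio_le hlaw hq N hint
  calc _ ≤ ∑ n ∈ Finset.range N, C * (1 / δ * (1 - ∫ x, sqrtRatio Λ (transportIter p F Λ n)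
        (transportIter p F Λ (n + 1)) F J x ∂(p.prod (transportIter p F Λ n))) + 2 * δ) := by
        refine Finset.sum_le_sum fun n _ => ?_
        exact (h.integral_abs_integral_sub_le (hac n) (hac (n + 1)) hg hC).trans
          (mul_le_mul_of_nonneg_left (h.integral_abs_densityGap_le (hac n) (hac (n + 1)) hδ) hC0)
    _ = C * (1 / δ * (∑ n ∈ Finset.range N, (1 - ∫ x, sqrtRatio Λ (transportIter p F Λ n)
        (transportIter p F Λ (n + 1)) F J x ∂(p.prod (transportIter p F Λ n)))) + 2 * δ * N) := by
        rw [← Finset.mul_sum, Finset.sum_add_distrib, ← Finset.mul_sum]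
        simp only [Finset.sum_const, Finset.card_range, nsmul_eq_mul]
        ring
    _ ≤ _ := by
        refine mul_le_mul_of_nonneg_left ?_ hC0
        refine add_le_add ?_ le_rfl
        calc _ ≤ 1 / δ * (1 / 2 * (1 + ∫ w, |∑ n ∈ Finset.range N,
              Real.log (J (i n w, q n w))| ∂M)) :=
              mul_le_mul_of_nonneg_left h1 (by positivity)
          _ = _ := by field_simp

end Entropy

/-! ### Equal Lyapunov exponents -/

section Exponents

variable {α : Type*} [MeasurableSpace α] {m : Measure α} {T : α → α} {d : ℕ}
  {A : α → Matrix.GeneralLinearGroup (Fin d) ℝ}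

theorem integral_iterate (hT : MeasurePreserving T m m) {w : α → ℝ} (hw : Measurable w) (k : ℕ) :
    ∫ x, w (T^[k] x) ∂m = ∫ x, w x ∂m := by
  have h := hT.iterate k
  conv_rhs => rw [← h.map_eq]
  rw [integral_map h.measurable.aemeasurable hw.aestronglyMeasurable]

theorem integrable_iterate (hT : MeasurePreserving T m m) {w : α → ℝ} (hw : Integrable w m)
    (k : ℕ) : Integrable (fun x => w (T^[k] x)) m :=
  (hT.iterate k).integrable_comp_of_integrable hw

theorem integral_average (hT : MeasurePreserving T m m) {w : α → ℝ} (hwm : Measurable w)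
    (hw : Integrable w m) {n : ℕ} (hn : n ≠ 0) :
    ∫ x, (1 / (n : ℝ)) * ∑ k ∈ Finset.range n, w (T^[k] x) ∂m = ∫ x, w x ∂m := by
  rw [integral_const_mul, integral_finsetSum _ fun k _ => integrable_iterate hT hw k]
  simp only [integral_iterate hT hwm, Finset.sum_const, Finset.card_range, nsmul_eq_mul]
  field_simp

theorem integrable_average (hT : MeasurePreserving T m m) {w : α → ℝ} (hw : Integrable w m)
    (n : ℕ) : Integrable (fun x => (1 / (n : ℝ)) * ∑ k ∈ Finset.range n, w (T^[k] x)) m :=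
  (integrable_finsetSum _ fun k _ => integrable_iterate hT hw k).const_mul _

theorem tendsto_integral_posPart_sub {w : α → ℝ} (hwm : Measurable w) (hw : Integrable w m) :
    Tendsto (fun K : ℕ => ∫ x, max (w x - K) 0 ∂m) atTop (𝓝 0) := by
  have h : Tendsto (fun K : ℕ => ∫ x, max (w x - K) 0 ∂m) atTop (𝓝 (∫ _x, (0 : ℝ) ∂m)) := by
    refine tendsto_integral_of_dominated_convergence (fun x => |w x|) (fun K => ?_) hw.abs
      (fun K => ae_of_all _ fun x => ?_) (ae_of_all _ fun x => ?_)
    · exact ((hwm.sub_const _).max measurable_const).aestronglyMeasurable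
    · rw [Real.norm_of_nonneg (le_max_right _ _)]
      refine max_le ?_ (abs_nonneg _)
      have := le_abs_self (w x)
      have hK : (0 : ℝ) ≤ K := Nat.cast_nonneg K
      linarith
    · refine tendsto_const_nhds.congr' ?_
      filter_upwards [eventually_ge_atTop ⌈w x⌉₊] with K hK
      rw [max_eq_right]
      have := (Nat.le_ceil (w x)).trans (Nat.cast_le.2 hK)
      linarith
  simpa using h

/-- Birkhoff averages of an integrable function are uniformly integrable. Hence functions they
dominate converge in mean as soon as they converge almost everywhere. -/
theorem tendsto_integral_of_le_average [IsFiniteMeasure m] (hT : MeasurePreserving T m m)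
    {w : α → ℝ} (hwm : Measurable w) (hw : Integrable w m) {u : ℕ → α → ℝ}
    (hum : ∀ n, Measurable (u n)) (hu0 : ∀ n x, 0 ≤ u n x)
    (hu : ∀ n x, u n x ≤ (1 / (n : ℝ)) * ∑ k ∈ Finset.range n, w (T^[k] x))
    (hlim : ∀ᵐ x ∂m, Tendsto (fun n => u n x) atTop (𝓝 0)) :
    Tendsto (fun n => ∫ x, u n x ∂m) atTop (𝓝 0) := by
  have huint : ∀ n, Integrable (u n) m := fun n =>
    (integrable_average hT hw n).mono' (hum n).aestronglyMeasurable
      (ae_of_all _ fun x => by rw [Real.norm_of_nonneg (hu0 n x)]; exact hu n x)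
  have htrunc : ∀ K : ℕ, Tendsto (fun n => ∫ x, min (u n x) K ∂m) atTop (𝓝 0) := by
    intro K
    have h : Tendsto (fun n => ∫ x, min (u n x) K ∂m) atTop (𝓝 (∫ _x, (0 : ℝ) ∂m)) := by
      refine tendsto_integral_of_dominated_convergence (fun _ => (K : ℝ)) (fun n => ?_)
        (integrable_const _) (fun n => ae_of_all _ fun x => ?_) ?_
      · exact ((hum n).min measurable_const).aestronglyMeasurable
      · rw [Real.norm_of_nonneg (le_min (hu0 n x) (Nat.cast_nonneg K))]
        exact min_le_right _ _
      · filter_upwards [hlim] with x hx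
        have := hx.min (tendsto_const_nhds (x := (K : ℝ)))
        rwa [min_eq_left (Nat.cast_nonneg K)] at this
    simpa using h
  -- Since `w ≤ K + (w - K)⁺`, the excess of `u n` over `K` is at most an average of `(w - K)⁺`.
  have hbound : ∀ (K n : ℕ), n ≠ 0 → ∫ x, u n x ∂m ≤
      ∫ x, min (u n x) K ∂m + ∫ x, max (w x - K) 0 ∂m := by
    intro K n hn
    have hwK : Integrable (fun x => max (w x - K) 0) m :=
      (hw.sub (integrable_const _)).pos_part
    have hwKm : Measurable fun x => max (w x - K) 0 := (hwm.sub_const _).max measurable_const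
    rw [← integral_average hT hwKm hwK hn, ← integral_add ?_ (integrable_average hT hwK n)]
    · refine integral_mono (huint n) (((huint n).inf (integrable_const _)).add
        (integrable_average hT hwK n)) fun x => ?_
      have hn' : (0 : ℝ) < n := by positivity
      have h1 : (1 / (n : ℝ)) * ∑ k ∈ Finset.range n, w (T^[k] x) ≤
          K + (1 / (n : ℝ)) * ∑ k ∈ Finset.range n, max (w (T^[k] x) - K) 0 := by
        have : ∑ k ∈ Finset.range n, w (T^[k] x) ≤
            ∑ k ∈ Finset.range n, ((K : ℝ) + max (w (T^[k] x) - K) 0) :=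
          Finset.sum_le_sum fun k _ => by
            have := le_max_left (w (T^[k] x) - K) 0
            linarith
        rw [Finset.sum_add_distrib, Finset.sum_const, Finset.card_range, nsmul_eq_mul] at this
        calc _ ≤ (1 / (n : ℝ)) * (n * K + ∑ k ∈ Finset.range n, max (w (T^[k] x) - K) 0) :=
              mul_le_mul_of_nonneg_left this (by positivity)
          _ = _ := by field_simp
      have h2 : 0 ≤ (1 / (n : ℝ)) * ∑ k ∈ Finset.range n, max (w (T^[k] x) - K) 0 :=
        mul_nonneg (by positivity) (Finset.sum_nonneg fun k _ => le_max_right _ _)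
      have h3 := hu n x
      rcases le_total (u n x) K with h | h
      · change u n x ≤ min (u n x) K + _
        rw [min_eq_left h]; linarith
      · change u n x ≤ min (u n x) K + _
        rw [min_eq_right h]; linarith
    · exact (huint n).inf (integrable_const _)
  rw [Metric.tendsto_atTop]
  intro ε hε
  obtain ⟨K, hK⟩ := ((tendsto_order.1 (tendsto_integral_posPart_sub hwm hw)).2 (ε / 2)
    (by positivity)).exists
  obtain ⟨N, hN⟩ := eventually_atTop.1 ((tendsto_order.1 (htrunc K)).2 (ε / 2) (by positivity))
  refine ⟨max N 1, fun n hn => ?_⟩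
  have hn0 : n ≠ 0 := by have := (le_max_right N 1).trans hn; omega
  rw [Real.dist_eq, sub_zero, abs_of_nonneg (integral_nonneg fun x => hu0 n x)]
  have h1 := hbound K n hn0
  have h2 := hN n ((le_max_left N 1).trans hn)
  linarith

/-- By Fatou's lemma, the Birkhoff averages of a nonnegative integrable function do not tend to
infinity. This is all that is needed in place of the ergodic theorem. -/
theorem ae_exists_frequently_average_le (hT : MeasurePreserving T m m) {w : α → ℝ}
    (hwm : Measurable w) (hw : Integrable w m) (hw0 : ∀ x, 0 ≤ w x) :
    ∀ᵐ x ∂m, ∃ K : ℝ, ∃ᶠ n : ℕ in atTop,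
      (1 / (n : ℝ)) * ∑ k ∈ Finset.range n, w (T^[k] x) ≤ K := by
  let a : ℕ → α → ℝ := fun n x => (1 / (n : ℝ)) * ∑ k ∈ Finset.range n, w (T^[k] x)
  have ha0 : ∀ n x, 0 ≤ a n x := fun n x =>
    mul_nonneg (by positivity) (Finset.sum_nonneg fun k _ => hw0 _)
  have ham : ∀ n, Measurable (a n) := fun n =>
    (Finset.measurable_sum _ fun k _ => hwm.comp (hT.iterate k).measurable).const_mul _
  have hlint : ∀ n, ∫⁻ x, ENNReal.ofReal (a n x) ∂m ≤ ENNReal.ofReal (∫ x, w x ∂m) := by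
    intro n
    rw [← ofReal_integral_eq_lintegral_ofReal (integrable_average hT hw n) (ae_of_all _ (ha0 n))]
    refine ENNReal.ofReal_le_ofReal ?_
    rcases eq_or_ne n 0 with rfl | hn
    · simpa [a] using integral_nonneg hw0
    · exact (integral_average hT hwm hw hn).le
  have hfatou : ∫⁻ x, liminf (fun n => ENNReal.ofReal (a n x)) atTop ∂m < ⊤ := by
    refine (lintegral_liminf_le fun n => (ham n).ennreal_ofReal).trans_lt ?_
    refine lt_of_le_of_lt ?_ (ENNReal.ofReal_lt_top (r := ∫ x, w x ∂m))
    exact liminf_le_of_frequently_le' (Frequently.of_forall hlint)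
  filter_upwards [ae_lt_top (Measurable.liminf fun n => (ham n).ennreal_ofReal) hfatou.ne] with x hx
  obtain ⟨K, hK1, hK2⟩ := ENNReal.lt_iff_exists_nnreal_btwn.1 hx
  refine ⟨K, (frequently_lt_of_liminf_lt (by isBoundedDefault) hK1).mono fun n hn => ?_⟩
  have := hn.le
  rwa [ENNReal.ofReal_le_iff_le_toReal ENNReal.coe_ne_top, ENNReal.coe_toReal] at this

theorem measurableGL_cocycleIter (hT : Measurable T) (hA : MeasurableGL A) (n : ℕ) :
    MeasurableGL (cocycleIter T A n) := by
  induction n with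
  | zero => exact fun i j => measurable_const
  | succ n ih =>
    exact MeasurableGL.mul (A := fun x => A (T^[n] x))
      (fun i j => (hA i j).comp (hT.iterate n)) ih

theorem log_opNorm_cocycleIter_le {α : Type*} {T : α → α}
    {A : α → Matrix.GeneralLinearGroup (Fin d) ℝ} (hd : 1 ≤ d) (n : ℕ) (x : α) :
    Real.log (opNorm (cocycleIter T A n x)) ≤
      ∑ k ∈ Finset.range n, Real.posLog (opNorm (A (T^[k] x))) := by
  induction n with
  | zero => simp [cocycleIter, opNorm_one hd]
  | succ n ih =>
    rw [Finset.sum_range_succ, cocycleIter]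
    have h1 := opNorm_pos hd (A (T^[n] x))
    have h2 := opNorm_pos hd (cocycleIter T A n x)
    have := Real.log_le_log (opNorm_pos hd _) (opNorm_mul_le (A (T^[n] x)) (cocycleIter T A n x))
    rw [Real.log_mul h1.ne' h2.ne'] at this
    have h3 : Real.log (opNorm (A (T^[n] x))) ≤ Real.posLog (opNorm (A (T^[n] x))) :=
      le_max_right _ _
    linarith

theorem log_opNorm_inv_cocycleIter_le {α : Type*} {T : α → α}
    {A : α → Matrix.GeneralLinearGroup (Fin d) ℝ} (hd : 1 ≤ d) (n : ℕ) (x : α) :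
    Real.log (opNorm (cocycleIter T A n x)⁻¹) ≤
      ∑ k ∈ Finset.range n, Real.posLog (opNorm (A (T^[k] x))⁻¹) := by
  induction n with
  | zero => simp [cocycleIter, opNorm_one hd]
  | succ n ih =>
    rw [Finset.sum_range_succ, cocycleIter, mul_inv_rev]
    have h1 := opNorm_pos hd (A (T^[n] x))⁻¹
    have h2 := opNorm_pos hd (cocycleIter T A n x)⁻¹
    have := Real.log_le_log (opNorm_pos hd _)
      (opNorm_mul_le (cocycleIter T A n x)⁻¹ (A (T^[n] x))⁻¹)
    rw [Real.log_mul h2.ne' h1.ne'] at this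
    have h3 : Real.log (opNorm (A (T^[n] x))⁻¹) ≤ Real.posLog (opNorm (A (T^[n] x))⁻¹) :=
      le_max_right _ _
    linarith

/-- The logarithm `log (‖B‖ ‖B⁻¹‖)` of the condition number of `B`. -/
noncomputable def logCond (B : Matrix.GeneralLinearGroup (Fin d) ℝ) : ℝ :=
  Real.log (opNorm B) + Real.log (opNorm B⁻¹)

theorem logCond_nonneg (hd : 1 ≤ d) (B : Matrix.GeneralLinearGroup (Fin d) ℝ) :
    0 ≤ logCond B := by
  rw [logCond, ← Real.log_mul (opNorm_pos hd B).ne' (opNorm_pos hd B⁻¹).ne']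
  exact Real.log_nonneg (one_le_opNorm_mul hd B)

theorem MeasurableGL.measurable_logCond (hA : MeasurableGL A) :
    Measurable fun x => logCond (A x) :=
  hA.measurable_opNorm.log.add hA.inv.measurable_opNorm.log

/-- The sum `log⁺ ‖B‖ + log⁺ ‖B⁻¹‖`. -/
noncomputable def posLogSum (B : Matrix.GeneralLinearGroup (Fin d) ℝ) : ℝ :=
  Real.posLog (opNorm B) + Real.posLog (opNorm B⁻¹)

theorem MeasurableGL.measurable_posLogSum (hA : MeasurableGL A) :
    Measurable fun x => posLogSum (A x) :=
  (measurable_const.max hA.measurable_opNorm.log).add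
    (measurable_const.max hA.inv.measurable_opNorm.log)

theorem posLogSum_nonneg (B : Matrix.GeneralLinearGroup (Fin d) ℝ) : 0 ≤ posLogSum B :=
  add_nonneg Real.posLog_nonneg Real.posLog_nonneg

theorem logCond_cocycleIter_le {α : Type*} {T : α → α}
    {A : α → Matrix.GeneralLinearGroup (Fin d) ℝ} (hd : 1 ≤ d) (n : ℕ) (x : α) :
    logCond (cocycleIter T A n x) ≤ ∑ k ∈ Finset.range n, posLogSum (A (T^[k] x)) := by
  simp only [posLogSum, Finset.sum_add_distrib]
  exact add_le_add (log_opNorm_cocycleIter_le hd n x) (log_opNorm_inv_cocycleIter_le hd n x)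

theorem integrable_logCond_cocycleIter (hd : 1 ≤ d) (hT : MeasurePreserving T m m)
    (hA : MeasurableGL A) (hint : Integrable (fun x => posLogSum (A x)) m) (n : ℕ) :
    Integrable (fun x => logCond (cocycleIter T A n x)) m := by
  refine (integrable_finsetSum (Finset.range n) fun k _ => integrable_iterate hT hint k).mono'
    (measurableGL_cocycleIter hT.measurable hA n).measurable_logCond.aestronglyMeasurable
    (ae_of_all _ fun x => ?_)
  rw [Real.norm_of_nonneg (logCond_nonneg hd _)]
  exact logCond_cocycleIter_le hd n x

/-- Equality of the extremal exponents means that the condition number of `A^n` grows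
subexponentially. The exponents are a priori elements of `[-∞, ∞]`; integrability excludes the
infinite values. -/
theorem ae_tendsto_logCond (hd : 1 ≤ d) (hT : MeasurePreserving T m m) (hA : MeasurableGL A)
    (hint : Integrable (fun x => posLogSum (A x)) m)
    (hlam : lyapunovMin m T A = lyapunovMax m T A) :
    ∀ᵐ x ∂m, Tendsto (fun n : ℕ => (1 / (n : ℝ)) * logCond (cocycleIter T A n x)) atTop (𝓝 0) := by
  set lam := lyapunovMax m T A with hl
  have hsup : ∀ᵐ x ∂m, limsup (fun n : ℕ => (((1 / (n : ℝ)) *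
      Real.log (opNorm (cocycleIter T A n x)) : ℝ) : EReal)) atTop ≤ lam := ae_le_essSup
  have hinf : ∀ᵐ x ∂m, lam ≤ liminf (fun n : ℕ => (((1 / (n : ℝ)) *
      Real.log ((opNorm ((cocycleIter T A n x)⁻¹))⁻¹) : ℝ) : EReal)) atTop := by
    rw [← hlam]
    exact ae_essInf_le
  filter_upwards [hsup, hinf, ae_exists_frequently_average_le hT hA.measurable_posLogSum hint
    fun x => posLogSum_nonneg _] with x h1 h2 hK
  obtain ⟨K, hK⟩ := hK
  set v : ℕ → ℝ := fun n => (1 / (n : ℝ)) * Real.log (opNorm (cocycleIter T A n x)) with hv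
  set v' : ℕ → ℝ := fun n =>
    (1 / (n : ℝ)) * Real.log ((opNorm ((cocycleIter T A n x)⁻¹))⁻¹) with hv'
  have hn0 : ∀ n : ℕ, 0 ≤ 1 / (n : ℝ) := fun n => by positivity
  have hdiff : ∀ n, v n - v' n = (1 / (n : ℝ)) * logCond (cocycleIter T A n x) := by
    intro n
    simp only [hv, hv', logCond, Real.log_inv]
    ring
  have hle : ∀ n, v' n ≤ v n := fun n => by
    have := mul_nonneg (hn0 n) (logCond_nonneg hd (cocycleIter T A n x))
    rw [← hdiff] at this
    linarith
  have hle' : ∀ n, (v' n : EReal) ≤ v n := fun n => EReal.coe_le_coe_iff.2 (hle n)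
  have hmono : liminf (fun n => (v' n : EReal)) atTop ≤ liminf (fun n => (v n : EReal)) atTop :=
    liminf_le_liminf (Eventually.of_forall hle')
  have hmono' : limsup (fun n => (v' n : EReal)) atTop ≤ limsup (fun n => (v n : EReal)) atTop :=
    limsup_le_limsup (Eventually.of_forall hle')
  have hvlim : Tendsto (fun n => (v n : EReal)) atTop (𝓝 lam) :=
    tendsto_of_le_liminf_of_limsup_le (h2.trans hmono) h1
  have hv'lim : Tendsto (fun n => (v' n : EReal)) atTop (𝓝 lam) :=
    tendsto_of_le_liminf_of_limsup_le h2 (hmono'.trans h1)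
  -- Both sequences are infinitely often bounded, so that their common limit is finite.
  have hbd : ∃ᶠ n in atTop, (v n : EReal) ∈ Set.Icc ((-K : ℝ) : EReal) (K : ℝ) := by
    refine hK.mono fun n hn => ?_
    have hup : v n ≤ (1 / (n : ℝ)) * ∑ k ∈ Finset.range n, posLogSum (A (T^[k] x)) := by
      refine mul_le_mul_of_nonneg_left ((log_opNorm_cocycleIter_le hd n x).trans ?_) (hn0 n)
      exact Finset.sum_le_sum fun k _ => le_add_of_nonneg_right Real.posLog_nonneg
    have hlow : -v' n ≤ (1 / (n : ℝ)) * ∑ k ∈ Finset.range n, posLogSum (A (T^[k] x)) := by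
      have : -v' n = (1 / (n : ℝ)) * Real.log (opNorm (cocycleIter T A n x)⁻¹) := by
        simp only [hv', Real.log_inv]; ring
      rw [this]
      refine mul_le_mul_of_nonneg_left ((log_opNorm_inv_cocycleIter_le hd n x).trans ?_) (hn0 n)
      exact Finset.sum_le_sum fun k _ => le_add_of_nonneg_left Real.posLog_nonneg
    have := hle n
    exact ⟨EReal.coe_le_coe_iff.2 (by linarith), EReal.coe_le_coe_iff.2 (by linarith)⟩
  have hmem : lam ∈ Set.Icc ((-K : ℝ) : EReal) (K : ℝ) :=
    isClosed_Icc.mem_of_frequently_of_tendsto hbd hvlim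
  have hbot : lam ≠ ⊥ := ((EReal.bot_lt_coe _).trans_le hmem.1).ne'
  have htop : lam ≠ ⊤ := (hmem.2.trans_lt (EReal.coe_lt_top _)).ne
  have hreal : ((lam.toReal : ℝ) : EReal) = lam := EReal.coe_toReal htop hbot
  rw [← hreal] at hvlim hv'lim
  have := (EReal.tendsto_coe.1 hvlim).sub (EReal.tendsto_coe.1 hv'lim)
  rw [sub_self] at this
  exact this.congr hdiff

theorem tendsto_integral_logCond [IsFiniteMeasure m] (hd : 1 ≤ d) (hT : MeasurePreserving T m m)
    (hA : MeasurableGL A) (hint : Integrable (fun x => posLogSum (A x)) m)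
    (hlam : lyapunovMin m T A = lyapunovMax m T A) :
    Tendsto (fun n : ℕ => (1 / (n : ℝ)) * ∫ x, logCond (cocycleIter T A n x) ∂m) atTop (𝓝 0) := by
  have := tendsto_integral_of_le_average hT hA.measurable_posLogSum hint
    (u := fun n x => (1 / (n : ℝ)) * logCond (cocycleIter T A n x))
    (fun n => (measurableGL_cocycleIter hT.measurable hA n).measurable_logCond.const_mul _)
    (fun n x => mul_nonneg (by positivity) (logCond_nonneg hd _))
    (fun n x => mul_le_mul_of_nonneg_left (logCond_cocycleIter_le hd n x) (by positivity))
    (ae_tendsto_logCond hd hT hA hint hlam)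
  simpa only [integral_const_mul] using this

end Exponents

/-! ### The skew-product and its random orbits -/

section SkewProduct

variable {X Y S : Type*} {d : ℕ}

/-- The skew-product of the random cocycle, as a single random map of `X × P(ℝ^d)`. -/
noncomputable def fiberMaps {d : ℕ} (f : Y → X → X)
    (Afib : Y → X → Matrix.GeneralLinearGroup (Fin d) ℝ) (a : Y × (X × ProjSpace d)) :
    X × ProjSpace d :=
  fiberMap (f a.1) (Afib a.1) a.2

/-- The Jacobian of the skew-product along the projective fibers. -/
noncomputable def fiberJac {d : ℕ} (Afib : Y → X → Matrix.GeneralLinearGroup (Fin d) ℝ)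
    (a : Y × (X × ProjSpace d)) : ℝ :=
  projJac (Afib a.1 a.2.1 : Matrix (Fin d) (Fin d) ℝ) a.2.2

/-- The random orbit of the point `w.2` under the samples `w.1 0, w.1 1, …`. -/
def orbit (F : Y × S → S) : ℕ → (ℤ → Y) × S → S
  | 0, w => w.2
  | n + 1, w => F (w.1 n, orbit F n w)

variable {f : Y → X → X} {Afib : Y → X → Matrix.GeneralLinearGroup (Fin d) ℝ}

/-- The cocycle over the skew-shift with the given fiber cocycles. -/
def fiberCocycle (Afib : Y → X → Matrix.GeneralLinearGroup (Fin d) ℝ) (z : (ℤ → Y) × X) :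
    Matrix.GeneralLinearGroup (Fin d) ℝ :=
  Afib (z.1 0) z.2

theorem iterate_skewShift_eq (w : (ℤ → Y) × (X × ProjSpace d)) (n : ℕ) :
    (skewShift f)^[n] (w.1, w.2.1) = (fun k => w.1 (k + n), (orbit (fiberMaps f Afib) n w).1) := by
  induction n with
  | zero => simp [orbit]
  | succ n ih =>
    rw [Function.iterate_succ_apply', ih]
    simp only [skewShift, orbit, fiberMaps, fiberMap, zero_add, Prod.mk.injEq, and_true]
    funext k
    exact congrArg w.1 (by push_cast; ring)

theorem fiberCocycle_iterate (w : (ℤ → Y) × (X × ProjSpace d)) (n : ℕ) :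
    fiberCocycle Afib ((skewShift f)^[n] (w.1, w.2.1)) =
      Afib (w.1 n) (orbit (fiberMaps f Afib) n w).1 := by
  rw [iterate_skewShift_eq (Afib := Afib)]
  simp [fiberCocycle]

theorem orbit_snd_eq (w : (ℤ → Y) × (X × ProjSpace d)) (n : ℕ) :
    (orbit (fiberMaps f Afib) n w).2 =
      cocycleIter (skewShift f) (fiberCocycle Afib) n (w.1, w.2.1) • w.2.2 := by
  induction n with
  | zero => simp [orbit, cocycleIter]
  | succ n ih =>
    rw [cocycleIter, mul_smul, ← ih, fiberCocycle_iterate]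
    rfl

/-- By the chain rule, the Jacobians along an orbit multiply to the Jacobian of the iterated
the cocycle. -/
theorem sum_log_fiberJac_eq (w : (ℤ → Y) × (X × ProjSpace d)) (N : ℕ) :
    ∑ n ∈ Finset.range N, Real.log (fiberJac Afib (w.1 n, orbit (fiberMaps f Afib) n w)) =
      Real.log (projJac (cocycleIter (skewShift f) (fiberCocycle Afib) N (w.1, w.2.1) :
        Matrix (Fin d) (Fin d) ℝ) w.2.2) := by
  induction N with
  | zero => rw [Finset.sum_range_zero, cocycleIter, projJac_one, Real.log_one]
  | succ N ih =>
    rw [Finset.sum_range_succ, ih, cocycleIter, projJac_mul, Real.log_mul (projJac_pos _ _).ne'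
      (projJac_pos _ _).ne', fiberCocycle_iterate, ← orbit_snd_eq, add_comm]
    rfl

end SkewProduct

/-! ### Laws of random orbits -/

section Laws

variable {X Y : Type*} [MeasurableSpace X] [MeasurableSpace Y] {p : Measure Y}
  [IsProbabilityMeasure p] {μ : Measure X}

instance instIsProbabilityMeasureBernoulliMeasure : IsProbabilityMeasure (bernoulliMeasure p) :=
  inferInstanceAs (IsProbabilityMeasure (Measure.infinitePi fun _ : ℤ => p))

instance instIsProbabilityMeasureBarMeasure [IsProbabilityMeasure μ] :
    IsProbabilityMeasure (barMeasure p μ) :=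
  inferInstanceAs (IsProbabilityMeasure ((bernoulliMeasure p).prod μ))

theorem measurePreserving_eval_bernoulliMeasure (k : ℤ) :
    MeasurePreserving (fun ω : ℤ → Y => ω k) (bernoulliMeasure p) p :=
  measurePreserving_eval_infinitePi (fun _ : ℤ => p) k

namespace IsRandomTransformation

variable {f : Y → X → X}

theorem measurePreserving [IsProbabilityMeasure μ] (h : IsRandomTransformation p μ f) :
    MeasurePreserving (skewShift f) (barMeasure p μ) (barMeasure p μ) :=
  h.ergodic.toMeasurePreserving

theorem measurable_uncurry [IsProbabilityMeasure μ] (h : IsRandomTransformation p μ f) :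
    Measurable fun a : Y × X => f a.1 a.2 := by
  have h1 : Measurable fun a : Y × X => ((fun _ : ℤ => a.1, a.2) : (ℤ → Y) × X) :=
    (measurable_pi_lambda _ fun _ => measurable_fst).prodMk measurable_snd
  exact measurable_snd.comp (h.measurePreserving.measurable.comp h1)

/-- The coordinate `ω₀` can be read off from the image of `(ω, x)` under the skew-shift, as its
coordinate of index `-1`; so invariance of `ℙ × μ` passes to the map `(ω₀, x) ↦ (ω₀, f_{ω₀}(x))`. -/
theorem measurePreserving_prodMk [IsProbabilityMeasure μ] (h : IsRandomTransformation p μ f) :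
    MeasurePreserving (fun a : Y × X => (a.1, f a.1 a.2)) (p.prod μ) (p.prod μ) := by
  have hf := h.measurable_uncurry
  have hk : ∀ k : ℤ, MeasurePreserving (fun z : (ℤ → Y) × X => (z.1 k, z.2))
      (barMeasure p μ) (p.prod μ) := fun k =>
    (measurePreserving_eval_bernoulliMeasure k).prod (MeasurePreserving.id μ)
  have hg : Measurable fun a : Y × X => (a.1, f a.1 a.2) := measurable_fst.prodMk hf
  refine ⟨hg, ?_⟩
  have h1 := ((hk (-1)).comp h.measurePreserving).map_eq
  have h2 : (fun z : (ℤ → Y) × X => (z.1 (-1), z.2)) ∘ skewShift f =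
      (fun a : Y × X => (a.1, f a.1 a.2)) ∘ fun z : (ℤ → Y) × X => (z.1 0, z.2) := by
    funext z
    simp [skewShift]
  rw [h2, ← Measure.map_map hg (hk 0).measurable, (hk 0).map_eq] at h1
  exact h1

/-- The image of `p × μ` under `(i, x) ↦ (i, f i x)` disintegrates over `Y` into the images of `μ`
under the maps `f i`, so that invariance of `p × μ` forces almost every `f i` to preserve `μ`. -/
theorem ae_measurePreserving [StandardBorelSpace X] [IsProbabilityMeasure μ]
    (h : IsRandomTransformation p μ f) : ∀ᵐ i ∂p, MeasurePreserving (f i) μ μ := by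
  have hf := h.measurable_uncurry
  have hg := h.measurePreserving_prodMk.measurable
  have hmap := h.measurePreserving_prodMk.map_eq
  let κ : ProbabilityTheory.Kernel Y X :=
    (ProbabilityTheory.Kernel.id.prod (ProbabilityTheory.Kernel.const Y μ)).map fun a => f a.1 a.2
  have hκ : ∀ i, κ i = μ.map (f i) := by
    intro i
    rw [ProbabilityTheory.Kernel.map_apply _ hf, ProbabilityTheory.Kernel.prod_apply,
      ProbabilityTheory.Kernel.id_apply, ProbabilityTheory.Kernel.const_apply,
      Measure.dirac_prod, Measure.map_map hf measurable_prodMk_left]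
    rfl
  have hcomp : p.compProd κ = p.compProd (ProbabilityTheory.Kernel.const Y μ) := by
    rw [Measure.compProd_const]
    ext s hs
    rw [← hmap, Measure.map_apply hg hs, Measure.prod_apply (hg hs), Measure.compProd_apply hs]
    refine lintegral_congr fun i => ?_
    have hfi : Measurable (f i) := hf.comp measurable_prodMk_left
    rw [hκ, Measure.map_apply hfi (measurable_prodMk_left hs)]
    rfl
  filter_upwards [ProbabilityTheory.Kernel.ae_eq_of_compProd_eq hcomp] with i hi
  refine ⟨hf.comp measurable_prodMk_left, ?_⟩
  rw [← hκ, hi, ProbabilityTheory.Kernel.const_apply]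

end IsRandomTransformation

theorem measurable_fiberMaps {d : ℕ} {f : Y → X → X}
    {Afib : Y → X → Matrix.GeneralLinearGroup (Fin d) ℝ}
    (hf : Measurable fun a : Y × X => f a.1 a.2)
    (hA : MeasurableGL fun a : Y × X => Afib a.1 a.2) : Measurable (fiberMaps f Afib) := by
  have h1 : Measurable fun a : Y × (X × ProjSpace d) => (a.1, a.2.1) := by fun_prop
  have h2 : Measurable fun a : Y × (X × ProjSpace d) => ((a.1, a.2.1), a.2.2) := by fun_prop
  exact (hf.comp h1).prodMk (hA.measurable_smul.comp h2)

theorem measurable_fiberJac {d : ℕ} {Afib : Y → X → Matrix.GeneralLinearGroup (Fin d) ℝ}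
    (hA : MeasurableGL fun a : Y × X => Afib a.1 a.2) : Measurable (fiberJac Afib) := by
  have h2 : Measurable fun a : Y × (X × ProjSpace d) => ((a.1, a.2.1), a.2.2) := by fun_prop
  exact hA.measurable_projJac.comp h2

/-- The skew-product distorts `μ × m` by its Jacobian along the fibers, since `f i` preserves
`μ`. -/
theorem hasJacobian_fiberMaps {d : ℕ} (hd : 1 ≤ d) [StandardBorelSpace X] [IsProbabilityMeasure μ]
    {f : Y → X → X} {Afib : Y → X → Matrix.GeneralLinearGroup (Fin d) ℝ}
    (h : IsRandomTransformation p μ f) (hA : MeasurableGL fun a : Y × X => Afib a.1 a.2) :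
    HasJacobian p (μ.prod (refMeasure d)) (fiberMaps f Afib) (fiberJac Afib) := by
  have := isProbabilityMeasure_refMeasure hd
  have hF := measurable_fiberMaps h.measurable_uncurry hA
  have hJ := measurable_fiberJac hA
  refine ⟨hF, hJ, fun a => projJac_pos _ _, ?_⟩
  filter_upwards [h.ae_measurePreserving] with i hi
  have hFi : Measurable fun s => fiberMaps f Afib (i, s) := hF.comp measurable_prodMk_left
  have hJi : Measurable fun s => ENNReal.ofReal (fiberJac Afib (i, s)) :=
    (hJ.comp measurable_prodMk_left).ennreal_ofReal
  refine ⟨hFi, Measure.ext_of_lintegral _ fun g hg => ?_⟩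
  have hgF : Measurable fun s => g (fiberMaps f Afib (i, s)) := hg.comp hFi
  rw [lintegral_map hg hFi, lintegral_withDensity_eq_lintegral_mul _ hJi hgF,
    lintegral_prod _ (hJi.mul hgF).aemeasurable, lintegral_prod _ hg.aemeasurable,
    ← hi.lintegral_comp hg.lintegral_prod_right']
  refine lintegral_congr fun x => ?_
  have hgx : Measurable fun z => g (f i x, z) := hg.comp measurable_prodMk_left
  rw [← lintegral_smul_mul_projJac hd (Afib i x) hgx]
  exact lintegral_congr fun z => mul_comm _ _

/-- The sequence space `Y^ℕ` is the product of the space of first coordinates and of the space of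
remaining coordinates. -/
theorem measurePreserving_cons : MeasurePreserving
    (fun a : Y × (ℕ → Y) => (fun n : ℕ => Nat.casesOn n a.1 a.2 : ℕ → Y))
    (p.prod (Measure.infinitePi fun _ : ℕ => p)) (Measure.infinitePi fun _ : ℕ => p) := by
  have hm : Measurable
      (fun a : Y × (ℕ → Y) => (fun n : ℕ => Nat.casesOn n a.1 a.2 : ℕ → Y)) := by
    refine measurable_pi_lambda _ fun n => ?_
    cases n with
    | zero => exact measurable_fst
    | succ k => exact (measurable_pi_apply k).comp measurable_snd
  refine ⟨hm, Measure.eq_infinitePi _ fun s t ht => ?_⟩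
  classical
  -- Replace the finite set of constrained coordinates by an initial segment.
  let t' : ℕ → Set Y := fun n => if n ∈ s then t n else Set.univ
  have ht' : ∀ n, MeasurableSet (t' n) := fun n => by
    by_cases hn : n ∈ s
    · simpa [t', hn] using ht n
    · simp [t', hn]
  obtain ⟨N, hN⟩ := s.exists_nat_subset_range
  have hsub : s ⊆ Finset.range (N + 1) := hN.trans (Finset.range_mono N.le_succ)
  have hprod : ∏ n ∈ s, p (t n) = ∏ n ∈ Finset.range (N + 1), p (t' n) := by
    rw [← Finset.prod_subset hsub (fun n _ hn => by simp [t', hn])]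
    exact Finset.prod_congr rfl fun n hn => by simp [t', hn]
  have hpi : Set.pi (s : Set ℕ) t = Set.pi (Finset.range (N + 1) : Set ℕ) t' := by
    ext ω
    simp only [Set.mem_pi, Finset.mem_coe]
    constructor
    · intro hω n _
      by_cases hn : n ∈ s
      · simpa [t', hn] using hω n hn
      · simp [t', hn]
    · intro hω n hn
      simpa [t', hn] using hω n (hsub hn)
  have hpre : (fun a : Y × (ℕ → Y) => (fun n : ℕ => Nat.casesOn n a.1 a.2 : ℕ → Y)) ⁻¹'
      Set.pi (Finset.range (N + 1) : Set ℕ) t' =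
      t' 0 ×ˢ Set.pi (Finset.range N : Set ℕ) fun n => t' (n + 1) := by
    ext a
    simp only [Set.mem_preimage, Set.mem_pi, Finset.coe_range, Set.mem_Iio, Set.mem_prod]
    constructor
    · exact fun ha => ⟨ha 0 N.succ_pos, fun n hn => ha (n + 1) (Nat.succ_lt_succ hn)⟩
    · rintro ⟨h0, h1⟩ n hn
      cases n with
      | zero => exact h0
      | succ k => exact h1 k (Nat.lt_of_succ_lt_succ hn)
  rw [hprod, hpi, Measure.map_apply hm (MeasurableSet.pi (Finset.countable_toSet _)
    fun n _ => ht' n), hpre, Measure.prod_prod, Measure.infinitePi_pi _ fun n _ => ht' (n + 1),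
    Finset.prod_range_succ', mul_comm]

section Orbits

variable {S : Type*} [MeasurableSpace S] {F : Y × S → S}

/-- One step of the random dynamics, applied to a sequence of independent samples and an independent
point, produces again a sequence of independent samples and an independent point. -/
theorem measurePreserving_step (hF : Measurable F) {ν : Measure S} [IsProbabilityMeasure ν] :
    MeasurePreserving (fun a : (ℕ → Y) × S => ((fun k => a.1 (k + 1) : ℕ → Y), F (a.1 0, a.2)))
      ((Measure.infinitePi fun _ : ℕ => p).prod ν)
      ((Measure.infinitePi fun _ : ℕ => p).prod (transport p F ν)) := by
  have := isProbabilityMeasure_transport p hF ν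
  have hstep : Measurable
      (fun a : (ℕ → Y) × S => ((fun k => a.1 (k + 1) : ℕ → Y), F (a.1 0, a.2))) := by
    refine (measurable_pi_lambda _ fun k => ?_).prodMk (hF.comp ?_)
    · exact (measurable_pi_apply (k + 1)).comp measurable_fst
    · exact ((measurable_pi_apply 0).comp measurable_fst).prodMk measurable_snd
  have hcons := (measurePreserving_cons (p := p)).prod (MeasurePreserving.id ν)
  -- Rearrange `((i, ω), s)` as `(ω, (i, s))`.
  have hre : MeasurePreserving (fun a : (Y × (ℕ → Y)) × S => (a.1.2, (a.1.1, a.2)))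
      ((p.prod (Measure.infinitePi fun _ : ℕ => p)).prod ν)
      ((Measure.infinitePi fun _ : ℕ => p).prod (p.prod ν)) :=
    (measurePreserving_prodAssoc _ _ _).comp
      ((Measure.measurePreserving_swap).prod (MeasurePreserving.id ν))
  have hFp : MeasurePreserving F (p.prod ν) (transport p F ν) := ⟨hF, rfl⟩
  have h2 := ((MeasurePreserving.id (Measure.infinitePi fun _ : ℕ => p)).prod hFp).comp hre
  refine ⟨hstep, ?_⟩
  rw [← hcons.map_eq, Measure.map_map hstep hcons.measurable, ← h2.map_eq]
  rfl

/-- The position of a random orbit at time `n` is independent of the samples from time `n` on. -/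
theorem measurePreserving_future_orbit (hF : Measurable F) {Λ : Measure S}
    [IsProbabilityMeasure Λ] (n : ℕ) :
    MeasurePreserving
      (fun w : (ℤ → Y) × S => ((fun k => w.1 ((n + k : ℕ) : ℤ) : ℕ → Y), orbit F n w))
      ((bernoulliMeasure p).prod Λ)
      ((Measure.infinitePi fun _ : ℕ => p).prod (transportIter p F Λ n)) := by
  induction n with
  | zero =>
    have h1 : MeasurePreserving (fun (ω : ℤ → Y) (k : ℕ) => ω (k : ℤ)) (bernoulliMeasure p)
        (Measure.infinitePi fun _ : ℕ => p) :=
      ⟨measurable_pi_lambda _ fun k => measurable_pi_apply _,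
        Measure.map_infinitePi_infinitePi_of_inj (P := fun _ : ℤ => p) Nat.cast_injective⟩
    simpa [orbit, transportIter, Prod.map_def] using! h1.prod (MeasurePreserving.id Λ)
  | succ n ih =>
    have := isProbabilityMeasure_transportIter (p := p) (Λ := Λ) hF n
    have h := (measurePreserving_step (p := p) hF).comp ih
    have heq : (fun w : (ℤ → Y) × S =>
          ((fun k => w.1 ((n + 1 + k : ℕ) : ℤ) : ℕ → Y), orbit F (n + 1) w)) =
        (fun a : (ℕ → Y) × S => ((fun k => a.1 (k + 1) : ℕ → Y), F (a.1 0, a.2))) ∘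
          fun w => ((fun k => w.1 ((n + k : ℕ) : ℤ) : ℕ → Y), orbit F n w) := by
      funext w
      refine Prod.ext (funext fun k => ?_) rfl
      exact congrArg w.1 (by push_cast; ring)
    rw [heq]
    exact h

theorem measurePreserving_orbit (hF : Measurable F) {Λ : Measure S} [IsProbabilityMeasure Λ]
    (n : ℕ) : MeasurePreserving (fun w : (ℤ → Y) × S => (w.1 (n : ℤ), orbit F n w))
      ((bernoulliMeasure p).prod Λ) (p.prod (transportIter p F Λ n)) := by
  have := isProbabilityMeasure_transportIter (p := p) (Λ := Λ) hF n
  have h := ((measurePreserving_eval_infinitePi (fun _ : ℕ => p) 0).prod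
    (MeasurePreserving.id (transportIter p F Λ n))).comp (measurePreserving_future_orbit hF n)
  simpa [Function.comp_def, Prod.map_def] using h

end Orbits

/-! ### The defect of invariance -/

section Cocycle

variable {d : ℕ} {f : Y → X → X} {Afib : Y → X → Matrix.GeneralLinearGroup (Fin d) ℝ}

theorem ae_cocycleIter_eq {α : Type*} [MeasurableSpace α] {m : Measure α} {T : α → α}
    (hT : MeasurePreserving T m m) {A B : α → Matrix.GeneralLinearGroup (Fin d) ℝ}
    (h : ∀ᵐ x ∂m, A x = B x) : ∀ᵐ x ∂m, ∀ n, cocycleIter T A n x = cocycleIter T B n x := by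
  have h1 : ∀ᵐ x ∂m, ∀ n, A (T^[n] x) = B (T^[n] x) :=
    ae_all_iff.2 fun n => (hT.iterate n).quasiMeasurePreserving.ae h
  filter_upwards [h1] with x hx n
  induction n with
  | zero => rfl
  | succ n ih => rw [cocycleIter, cocycleIter, ih, hx]

/-- Along the successive laws of a random orbit started from `μ × m`, the mean defect of invariance
under the individual fiber maps tends to zero in the sense of Cesàro. By the estimate for densities
along random orbits, the sum of the first `N` defects is `O(δ⁻¹ (1 + E N) + δ N)` for every
`δ > 0`, where `E N = o(N)` is the mean logarithm of the condition number of the `N`-th iterate of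
the cocycle. -/
theorem tendsto_average_defect (hd : 1 ≤ d) [StandardBorelSpace X] [IsProbabilityMeasure μ]
    {A : (ℤ → Y) × X → Matrix.GeneralLinearGroup (Fin d) ℝ} (hA : IsRandomCocycle p μ f A Afib)
    (hint : Integrable (fun z => posLogSum (A z)) (barMeasure p μ))
    (hlam : lyapunovMin (barMeasure p μ) (skewShift f) A =
      lyapunovMax (barMeasure p μ) (skewShift f) A)
    {g : X × ProjSpace d → ℝ} (hg : Measurable g) {C : ℝ} (hC : ∀ s, |g s| ≤ C) :
    Tendsto (fun N : ℕ => (1 / (N : ℝ)) * ∑ n ∈ Finset.range N,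
      ∫ y, |∫ s, g (fiberMaps f Afib (y, s))
          ∂(transportIter p (fiberMaps f Afib) (μ.prod (refMeasure d)) n)
        - ∫ s, g s ∂(transportIter p (fiberMaps f Afib) (μ.prod (refMeasure d)) (n + 1))| ∂p)
      atTop (𝓝 0) := by
  have hm := isProbabilityMeasure_refMeasure hd
  have hR := hA.toIsRandomTransformation
  have hT := hR.measurePreserving
  have hJac := hasJacobian_fiberMaps hd hR hA.measurable_fib
  set F := fiberMaps f Afib with hF
  set Λ := μ.prod (refMeasure d) with hΛ
  set c₀ : ℝ := Real.log (d.factorial * d ^ d) with hc₀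
  let M : Measure ((ℤ → Y) × (X × ProjSpace d)) := (bernoulliMeasure p).prod Λ
  let E : ℕ → ℝ := fun N => ∫ x, logCond (cocycleIter (skewShift f) A N x) ∂(barMeasure p μ)
  have hbase : MeasurePreserving (fun w : (ℤ → Y) × (X × ProjSpace d) => (w.1, w.2.1)) M
      (barMeasure p μ) :=
    (MeasurePreserving.id (bernoulliMeasure p)).prod measurePreserving_fst
  have hlog : ∀ N : ℕ, ∀ᵐ w ∂M,
      |∑ n ∈ Finset.range N, Real.log (fiberJac Afib (w.1 n, orbit F n w))|
      ≤ c₀ + d * logCond (cocycleIter (skewShift f) A N (w.1, w.2.1)) := by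
    intro N
    filter_upwards [hbase.quasiMeasurePreserving.ae
      (ae_cocycleIter_eq (B := fiberCocycle Afib) hT hA.locally_constant)] with w hw
    rw [sum_log_fiberJac_eq, hw N]
    exact abs_log_projJac_le hd _ _
  have hcondint : ∀ N : ℕ, Integrable
      (fun w => c₀ + d * logCond (cocycleIter (skewShift f) A N (w.1, w.2.1))) M := fun N =>
    (integrable_const _).add ((hbase.integrable_comp_of_integrable
      (integrable_logCond_cocycleIter hd hT hA.measurable hint N)).const_mul _)
  have hsummeas : ∀ N : ℕ, Measurable fun w : (ℤ → Y) × (X × ProjSpace d) =>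
      ∑ n ∈ Finset.range N, Real.log (fiberJac Afib (w.1 n, orbit F n w)) := fun N =>
    Finset.measurable_sum _ fun n _ =>
      (hJac.measurable_jac.comp (measurePreserving_orbit (p := p) (Λ := Λ)
        hJac.measurable_map n).measurable).log
  have hsumint : ∀ N : ℕ, Integrable
      (fun w => ∑ n ∈ Finset.range N, Real.log (fiberJac Afib (w.1 n, orbit F n w))) M := fun N =>
    (hcondint N).mono' (hsummeas N).aestronglyMeasurable (hlog N)
  have hEle : ∀ N : ℕ, ∫ w, |∑ n ∈ Finset.range N,
      Real.log (fiberJac Afib (w.1 n, orbit F n w))| ∂M ≤ c₀ + d * E N := by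
    intro N
    refine (integral_mono_ae (hsumint N).abs (hcondint N) (hlog N)).trans (le_of_eq ?_)
    have hli := integrable_logCond_cocycleIter hd hT hA.measurable hint N
    have hli' : Integrable (fun w => logCond (cocycleIter (skewShift f) A N (w.1, w.2.1))) M :=
      hbase.integrable_comp_of_integrable hli
    rw [integral_add (integrable_const _) (hli'.const_mul _), integral_const_mul]
    simp only [integral_const, probReal_univ, one_smul, E]
    rw [← hbase.map_eq, integral_map hbase.measurable.aemeasurable]
    · exact (measurableGL_cocycleIter hT.measurable hA.measurable
        N).measurable_logCond.aestronglyMeasurable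
  have hE : Tendsto (fun N : ℕ => (1 / (N : ℝ)) * E N) atTop (𝓝 0) :=
    tendsto_integral_logCond hd hT hA.measurable hint hlam
  have hbound : ∀ (δ : ℝ), 0 < δ → ∀ N : ℕ, N ≠ 0 → (1 / (N : ℝ)) * ∑ n ∈ Finset.range N,
      ∫ y, |∫ s, g (F (y, s)) ∂(transportIter p F Λ n)
        - ∫ s, g s ∂(transportIter p F Λ (n + 1))| ∂p ≤
      C * (1 / (2 * δ) * ((1 + c₀) * (1 / (N : ℝ)) + d * ((1 / (N : ℝ)) * E N)) + 2 * δ) := by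
    intro δ hδ N hN
    have hN' : (0 : ℝ) < N := by positivity
    obtain ⟨s₀⟩ : Nonempty (X × ProjSpace d) := Λ.nonempty_of_neZero
    have hC0 : 0 ≤ C := (abs_nonneg _).trans (hC s₀)
    have h1 := hJac.sum_integral_abs_integral_sub_le (M := M) (i := fun n w => w.1 n)
      (q := orbit F) (fun n => measurePreserving_orbit hJac.measurable_map n) (fun _ _ => rfl) N
      (hsumint N) hg hC hδ
    have h2 := hEle N
    calc _ ≤ (1 / (N : ℝ)) * (C * (1 / (2 * δ) * (1 + (c₀ + d * E N)) + 2 * δ * N)) := by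
          refine mul_le_mul_of_nonneg_left (h1.trans (mul_le_mul_of_nonneg_left ?_ hC0))
            (by positivity)
          gcongr
      _ = _ := by field_simp; ring
  refine tendsto_order.2
    ⟨fun a ha => Eventually.of_forall fun N => ha.trans_le ?_, fun ε hε => ?_⟩
  · exact mul_nonneg (by positivity)
      (Finset.sum_nonneg fun n _ => integral_nonneg fun y => abs_nonneg _)
  · -- with this choice the term `2 C δ` that does not depend on `N` is at most `ε / 2`
    set δ : ℝ := ε / (4 * (|C| + 1)) with hδdef
    have hδ : 0 < δ := by positivity
    have hlim : Tendsto (fun N : ℕ => C * (1 / (2 * δ) * ((1 + c₀) * (1 / (N : ℝ))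
        + d * ((1 / (N : ℝ)) * E N)) + 2 * δ)) atTop
        (𝓝 (C * (1 / (2 * δ) * ((1 + c₀) * 0 + d * 0) + 2 * δ))) :=
      ((((tendsto_one_div_atTop_nhds_zero_nat.const_mul _).add (hE.const_mul _)).const_mul _).add
        tendsto_const_nhds).const_mul _
    have hlt : C * (1 / (2 * δ) * ((1 + c₀) * 0 + d * 0) + 2 * δ) < ε := by
      have h1 : C * δ ≤ (|C| + 1) * δ :=
        mul_le_mul_of_nonneg_right ((le_abs_self C).trans (by linarith)) hδ.le
      have h2 : (|C| + 1) * δ = ε / 4 := by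
        rw [hδdef]
        field_simp
      simp only [mul_zero, add_zero, zero_add]
      linarith
    filter_upwards [(tendsto_order.1 hlim).2 ε hlt, eventually_ne_atTop 0] with N h1 h2
    exact (hbound δ hδ N h2).trans_lt h1

end Cocycle

end Laws

/-! ### Weak limits and functions continuous in the fibers -/

section Caratheodory

open scoped BoundedContinuousFunction

/-- Random probability measures that agree almost surely on each bounded continuous function agree
almost surely. The exceptional null sets are controlled by a countable basis of the topology. -/
theorem ae_eq_of_forall_ae_integral_eq {Y E : Type*} [MeasurableSpace Y] {p : Measure Y}
    [TopologicalSpace E] [SecondCountableTopology E] [HasOuterApproxClosed E] [MeasurableSpace E]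
    [BorelSpace E] {κ ν : Y → Measure E} (hκ : ∀ᵐ i ∂p, IsProbabilityMeasure (κ i))
    (hν : ∀ᵐ i ∂p, IsProbabilityMeasure (ν i))
    (h : ∀ g : E →ᵇ ℝ, ∀ᵐ i ∂p, ∫ s, g s ∂(κ i) = ∫ s, g s ∂(ν i)) :
    ∀ᵐ i ∂p, κ i = ν i := by
  have hopen : ∀ U : Set E, IsOpen U → ∀ᵐ i ∂p, κ i U = ν i U := by
    intro U hU
    have hF : IsClosed Uᶜ := hU.isClosed_compl
    have hall : ∀ᵐ i ∂p, ∀ n, ∫ s, ((hF.apprSeq n s : NNReal) : ℝ) ∂(κ i) =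
        ∫ s, ((hF.apprSeq n s : NNReal) : ℝ) ∂(ν i) := by
      rw [ae_all_iff]
      intro n
      exact h ⟨⟨fun s => ((hF.apprSeq n s : NNReal) : ℝ), by fun_prop⟩, by
        obtain ⟨C, hC⟩ := (hF.apprSeq n).map_bounded'
        exact ⟨C, fun x y => hC x y⟩⟩
    filter_upwards [hall, hκ, hν] with i hi hκi hνi
    have hlim := HasOuterApproxClosed.tendsto_lintegral_apprSeq hF (κ i)
    have hlim' := HasOuterApproxClosed.tendsto_lintegral_apprSeq hF (ν i)
    have hcl : κ i Uᶜ = ν i Uᶜ := by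
      refine tendsto_nhds_unique hlim (hlim'.congr fun n => ?_)
      have hne := ((hF.apprSeq n).lintegral_lt_top_of_nnreal (κ i)).ne
      have hne' := ((hF.apprSeq n).lintegral_lt_top_of_nnreal (ν i)).ne
      refine ((ENNReal.toReal_eq_toReal_iff' hne hne').1 ?_).symm
      rw [BoundedContinuousFunction.toReal_lintegral_coe_eq_integral,
        BoundedContinuousFunction.toReal_lintegral_coe_eq_integral, hi n]
    rwa [prob_compl_eq_one_sub hU.measurableSet, prob_compl_eq_one_sub hU.measurableSet,
      ENNReal.sub_right_inj ENNReal.one_ne_top prob_le_one prob_le_one] at hcl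
  set b := TopologicalSpace.countableBasis E
  set S : Set (Set E) := (fun t => ⋂₀ t) '' {t : Set (Set E) | t.Finite ∧ t ⊆ b}
  have hS : S.Countable := (Set.countable_ofPred_finite_subset
    (TopologicalSpace.countable_countableBasis E)).image _
  have hbasis : TopologicalSpace.IsTopologicalBasis S :=
    TopologicalSpace.isTopologicalBasis_of_subbasis
      (TopologicalSpace.isBasis_countableBasis E).eq_generateFrom
  have hpi : IsPiSystem S := by
    rintro _ ⟨t, ht, rfl⟩ _ ⟨t', ht', rfl⟩ -
    exact ⟨t ∪ t', ⟨ht.1.union ht'.1, Set.union_subset ht.2 ht'.2⟩, Set.sInter_union t t'⟩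
  have hall : ∀ᵐ i ∂p, ∀ U ∈ S, κ i U = ν i U :=
    (ae_ball_iff hS).2 fun U hU => hopen U (hbasis.isOpen hU)
  filter_upwards [hall, hκ, hν] with i hi hκi hνi
  exact ext_of_generate_finite S
    ((BorelSpace.measurable_eq (α := E)).trans hbasis.borel_eq_generateFrom) hpi hi (by simp)

variable {X P : Type*} [MeasurableSpace X] [TopologicalSpace P] [CompactSpace P] [T2Space P]
  [SecondCountableTopology P]

/-- Point evaluations along a countable dense set embed `C(P, ℝ)` continuously and injectively into
a countable power of `ℝ`; by the Lusin-Souslin theorem they generate its Borel σ-algebra. -/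
theorem stronglyMeasurable_continuousMap {G : X → C(P, ℝ)} (hG : ∀ z, Measurable fun x => G x z) :
    StronglyMeasurable G := by
  borelize C(P, ℝ)
  obtain ⟨s, hs, hsd⟩ := TopologicalSpace.exists_countable_dense P
  have := hs.to_subtype
  have hemb : MeasurableEmbedding fun (φ : C(P, ℝ)) (z : s) => φ z := by
    refine Continuous.measurableEmbedding (continuous_pi fun z => ?_) fun φ ψ h => ?_
    · exact continuous_eval_const (z : P)
    · ext z
      refine congrFun (Continuous.ext_on hsd φ.continuous ψ.continuous fun z hz => ?_) z
      exact congrFun h ⟨z, hz⟩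
  have hm : Measurable G :=
    hemb.measurable_comp_iff.1 (measurable_pi_iff.2 fun z => hG z)
  exact hm.stronglyMeasurable

variable [TopologicalSpace X] [PolishSpace X] [BorelSpace X] [MeasurableSpace P] [BorelSpace P]

/-- Weak convergence of measures with a common marginal `μ` on `X` extends to bounded functions that
are measurable in `X` and continuous in `P`: such a function is an integrable map from `X` to
`C(P, ℝ)`, hence can be approximated in `L¹(μ)` by a continuous one. -/
theorem tendsto_integral_of_continuous_snd {μ : Measure X} [IsProbabilityMeasure μ]
    {ν : ℕ → ProbabilityMeasure (X × P)} {ν' : ProbabilityMeasure (X × P)}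
    (hν : Tendsto ν atTop (𝓝 ν'))
    (hfst : ∀ k, (ν k : Measure (X × P)).map Prod.fst = μ)
    (hfst' : (ν' : Measure (X × P)).map Prod.fst = μ)
    {g : X × P → ℝ} (hg : Measurable g) {C : ℝ} (hC : ∀ s, |g s| ≤ C)
    (hcont : ∀ x, Continuous fun z => g (x, z)) :
    Tendsto (fun k => ∫ s, g s ∂(ν k : Measure (X × P))) atTop
      (𝓝 (∫ s, g s ∂(ν' : Measure (X × P)))) := by
  let G : X → C(P, ℝ) := fun x => ⟨fun z => g (x, z), hcont x⟩
  have hGm : StronglyMeasurable G :=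
    stronglyMeasurable_continuousMap fun z => hg.comp (measurable_id.prodMk measurable_const)
  have hGi : Integrable G μ := by
    refine Integrable.of_bound hGm.aestronglyMeasurable |C| (ae_of_all _ fun x => ?_)
    refine (ContinuousMap.norm_le _ (abs_nonneg C)).2 fun z => ?_
    exact (hC (x, z)).trans (le_abs_self C)
  rw [Metric.tendsto_atTop]
  intro ε hε
  obtain ⟨φ, hφ, hφi⟩ := hGi.exists_boundedContinuous_integral_sub_le (ε := ε / 4) (by positivity)
  let ψ : X × P →ᵇ ℝ := BoundedContinuousFunction.ofNormedAddCommGroup (fun s => φ s.1 s.2)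
    (by fun_prop) ‖φ‖ fun s => ((φ s.1).norm_coe_le_norm s.2).trans (φ.norm_coe_le_norm s.1)
  have hclose : ∀ η : Measure (X × P), IsProbabilityMeasure η → η.map Prod.fst = μ →
      |∫ s, g s ∂η - ∫ s, ψ s ∂η| ≤ ε / 4 := by
    intro η _ hη
    have hgi : Integrable g η := Integrable.of_bound hg.aestronglyMeasurable C (ae_of_all _ hC)
    rw [← integral_sub hgi (ψ.integrable η)]
    refine (abs_integral_le_integral_abs).trans (le_trans ?_ hφ)
    have hdi : Integrable (fun x => ‖G x - φ x‖) (η.map Prod.fst) :=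
      hη ▸ (hGi.sub hφi).norm
    rw [← hη, integral_map measurable_fst.aemeasurable hdi.aestronglyMeasurable]
    refine integral_mono (hgi.sub (ψ.integrable η)).abs
      (hdi.comp_measurable measurable_fst) fun s => ?_
    exact (G s.1 - φ s.1).norm_coe_le_norm s.2
  have hψ := (ProbabilityMeasure.tendsto_iff_forall_integral_tendsto.1 hν) ψ
  obtain ⟨K, hK⟩ := Metric.tendsto_atTop.1 hψ (ε / 4) (by positivity)
  refine ⟨K, fun k hk => ?_⟩
  have h1 := hclose (ν k) inferInstance (hfst k)
  have h2 := hclose ν' inferInstance hfst'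
  have h3 := hK k hk
  rw [Real.dist_eq] at h3 ⊢
  rw [abs_le] at h1 h2
  rw [abs_lt] at h3 ⊢
  constructor <;> linarith [h1.1, h1.2, h2.1, h2.2, h3.1, h3.2]

/-- Probability measures on `X × P` with a fixed marginal on `X` are tight, because `P` is
compact. -/
theorem exists_subseq_tendsto_of_map_fst_eq {μ : Measure X} [IsProbabilityMeasure μ]
    (ν : ℕ → ProbabilityMeasure (X × P)) (hfst : ∀ k, (ν k : Measure (X × P)).map Prod.fst = μ) :
    ∃ (ν' : ProbabilityMeasure (X × P)) (φ : ℕ → ℕ), StrictMono φ ∧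
      Tendsto (ν ∘ φ) atTop (𝓝 ν') ∧ (ν' : Measure (X × P)).map Prod.fst = μ := by
  have hμ : IsTightMeasureSet {μ} := isTightMeasureSet_singleton
  have htight : IsTightMeasureSet {((ξ : ProbabilityMeasure (X × P)) : Measure (X × P)) |
      ξ ∈ Set.range ν} := by
    rw [isTightMeasureSet_iff_exists_isCompact_measure_compl_le] at hμ ⊢
    intro ε hε
    obtain ⟨K, hK, hKε⟩ := hμ ε hε
    refine ⟨K ×ˢ Set.univ, hK.prod isCompact_univ, ?_⟩
    rintro _ ⟨_, ⟨k, rfl⟩, rfl⟩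
    have hpre : (K ×ˢ (Set.univ : Set P))ᶜ = Prod.fst ⁻¹' Kᶜ := by ext; simp
    rw [hpre, ← Measure.map_apply measurable_fst hK.isClosed.measurableSet.compl, hfst k]
    exact hKε μ rfl
  obtain ⟨ν', -, φ, hφ, hlim⟩ := (isCompact_closure_of_isTightMeasureSet htight).tendsto_subseq
    fun k => subset_closure (Set.mem_range_self k)
  refine ⟨ν', φ, hφ, hlim, ?_⟩
  have := Measure.isProbabilityMeasure_map (μ := (ν' : Measure (X × P)))
    measurable_fst.aemeasurable
  refine ext_of_forall_integral_eq_of_IsFiniteMeasure fun g => ?_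
  have hψ := (ProbabilityMeasure.tendsto_iff_forall_integral_tendsto.1 hlim)
    (g.compContinuous ⟨Prod.fst, continuous_fst⟩)
  rw [integral_map measurable_fst.aemeasurable g.continuous.aestronglyMeasurable]
  refine tendsto_nhds_unique hψ (tendsto_const_nhds.congr fun k => ?_)
  rw [← hfst (φ k), integral_map measurable_fst.aemeasurable g.continuous.aestronglyMeasurable]
  rfl

end Caratheodory

/-! ### Limits of averaged laws -/

section Cesaro

open scoped BoundedContinuousFunction

/-- The average of the first `N + 1` terms of a sequence of measures. -/
noncomputable def cesaroMeasure {S : Type*} [MeasurableSpace S] (η : ℕ → Measure S) (N : ℕ) :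
    Measure S :=
  ((N + 1 : ℕ) : ENNReal)⁻¹ • ∑ n ∈ Finset.range (N + 1), η n

theorem map_cesaroMeasure {S T : Type*} [MeasurableSpace S] [MeasurableSpace T]
    {η : ℕ → Measure S} {π : S → T} (hπ : Measurable π) {μ : Measure T}
    (h : ∀ n, (η n).map π = μ) (N : ℕ) : (cesaroMeasure η N).map π = μ := by
  have hsum : (∑ n ∈ Finset.range (N + 1), η n).map π = ((N + 1 : ℕ) : ENNReal) • μ := by
    rw [← Measure.mapₗ_apply_of_measurable hπ, map_sum]
    simp [Measure.mapₗ_apply_of_measurable hπ, h, ← Nat.cast_smul_eq_nsmul ENNReal]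
  rw [cesaroMeasure, Measure.map_smul, hsum, smul_smul,
    ENNReal.inv_mul_cancel (by simp) (ENNReal.natCast_ne_top _), one_smul]

theorem isProbabilityMeasure_cesaroMeasure {S : Type*} [MeasurableSpace S] {η : ℕ → Measure S}
    (h : ∀ n, IsProbabilityMeasure (η n)) (N : ℕ) : IsProbabilityMeasure (cesaroMeasure η N) := by
  refine ⟨?_⟩
  rw [cesaroMeasure, Measure.smul_apply, Measure.finsetSum_apply]
  simp only [measure_univ, Finset.sum_const, Finset.card_range, nsmul_eq_mul, mul_one, smul_eq_mul]
  exact ENNReal.inv_mul_cancel (by simp) (ENNReal.natCast_ne_top _)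

theorem integral_cesaroMeasure {S : Type*} [MeasurableSpace S] {η : ℕ → Measure S}
    (N : ℕ) {g : S → ℝ} (hg : ∀ n, Integrable g (η n)) :
    ∫ s, g s ∂(cesaroMeasure η N) =
      (1 / ((N + 1 : ℕ) : ℝ)) * ∑ n ∈ Finset.range (N + 1), ∫ s, g s ∂(η n) := by
  rw [cesaroMeasure, integral_smul_measure, integral_finsetSum_measure fun n _ => hg n,
    ENNReal.toReal_inv, ENNReal.toReal_natCast, one_div, smul_eq_mul]

variable {X P Y : Type*} [MeasurableSpace X] [TopologicalSpace P] [CompactSpace P] [T2Space P]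
  [SecondCountableTopology P] [TopologicalSpace X] [PolishSpace X] [BorelSpace X]
  [MeasurableSpace P] [BorelSpace P] [MeasurableSpace Y] {p : Measure Y} [IsProbabilityMeasure p]
  {μ : Measure X} [IsProbabilityMeasure μ]

/-- If `F i` takes each `η n` to `η (n + 1)` up to an error that vanishes in the mean, then it
preserves the Cesàro averages of `η` up to an error that vanishes in the mean. -/
theorem tendsto_integral_abs_cesaroMeasure {S : Type*} [MeasurableSpace S] {F : Y × S → S}
    (hF : Measurable F) {η : ℕ → Measure S} (hη : ∀ n, IsProbabilityMeasure (η n))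
    {g : S → ℝ} (hg : Measurable g) {C : ℝ} (hC : ∀ s, |g s| ≤ C)
    (h : Tendsto (fun N : ℕ => (1 / (N : ℝ)) * ∑ n ∈ Finset.range N,
      ∫ i, |∫ s, g (F (i, s)) ∂(η n) - ∫ s, g s ∂(η (n + 1))| ∂p) atTop (𝓝 0)) :
    Tendsto (fun N : ℕ => ∫ i, |∫ s, g (F (i, s)) ∂(cesaroMeasure η N) -
      ∫ s, g s ∂(cesaroMeasure η N)| ∂p) atTop (𝓝 0) := by
  have hbound : ∀ (ν : Measure S) [IsProbabilityMeasure ν] (g' : S → ℝ), (∀ s, |g' s| ≤ C) →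
      |∫ s, g' s ∂ν| ≤ C := fun ν _ g' hg' => by
    simpa using norm_integral_le_of_norm_le_const (μ := ν) (f := g') (ae_of_all _ hg')
  have hmi : ∀ (ν : Measure S) [IsProbabilityMeasure ν] (c : ℝ),
      Integrable (fun i => |∫ s, g (F (i, s)) ∂ν - c|) p := fun ν _ c => by
    have hm : StronglyMeasurable fun i => ∫ s, g (F (i, s)) ∂ν :=
      (hg.comp hF).stronglyMeasurable.integral_prod_right'
    exact ((Integrable.of_bound hm.aestronglyMeasurable C
      (ae_of_all _ fun i => hbound ν _ fun s => hC _)).sub (integrable_const c)).abs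
  have hgi : ∀ n, Integrable g (η n) := fun n =>
    Integrable.of_bound hg.aestronglyMeasurable C (ae_of_all _ hC)
  have hgFi : ∀ i n, Integrable (fun s => g (F (i, s))) (η n) := fun i n =>
    Integrable.of_bound ((hg.comp hF).comp measurable_prodMk_left).aestronglyMeasurable C
      (ae_of_all _ fun s => hC _)
  have hprob := isProbabilityMeasure_cesaroMeasure hη
  -- the terms of the two averages cancel except for the first and the last
  have hpt : ∀ (N : ℕ) (i : Y), |∫ s, g (F (i, s)) ∂(cesaroMeasure η N) -
      ∫ s, g s ∂(cesaroMeasure η N)| ≤ (1 / ((N + 1 : ℕ) : ℝ)) * ∑ n ∈ Finset.range (N + 1),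
        |∫ s, g (F (i, s)) ∂(η n) - ∫ s, g s ∂(η (n + 1))| + (1 / ((N + 1 : ℕ) : ℝ)) * (2 * C) := by
    intro N i
    have htel := Finset.sum_range_sub (fun n => ∫ s, g s ∂(η n)) (N + 1)
    have heq : ∑ n ∈ Finset.range (N + 1), ∫ s, g (F (i, s)) ∂(η n) -
        ∑ n ∈ Finset.range (N + 1), ∫ s, g s ∂(η n) =
        ∑ n ∈ Finset.range (N + 1), (∫ s, g (F (i, s)) ∂(η n) - ∫ s, g s ∂(η (n + 1))) +
          (∫ s, g s ∂(η (N + 1)) - ∫ s, g s ∂(η 0)) := by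
      rw [← htel, Finset.sum_sub_distrib, Finset.sum_sub_distrib]
      ring
    rw [integral_cesaroMeasure N (hgFi i), integral_cesaroMeasure N hgi, ← mul_sub, heq, abs_mul,
      abs_of_nonneg (by positivity : (0 : ℝ) ≤ 1 / ((N + 1 : ℕ) : ℝ)), ← mul_add]
    refine mul_le_mul_of_nonneg_left ((abs_add_le _ _).trans (add_le_add
      (Finset.abs_sum_le_sum_abs _ _) ?_)) (by positivity)
    have h1 := hbound (η (N + 1)) g hC
    have h2 := hbound (η 0) g hC
    have h3 := abs_sub (∫ s, g s ∂(η (N + 1))) (∫ s, g s ∂(η 0))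
    linarith
  have hlim : Tendsto (fun N : ℕ => (1 / ((N + 1 : ℕ) : ℝ)) * ∑ n ∈ Finset.range (N + 1),
      ∫ i, |∫ s, g (F (i, s)) ∂(η n) - ∫ s, g s ∂(η (n + 1))| ∂p +
        (1 / ((N + 1 : ℕ) : ℝ)) * (2 * C)) atTop (𝓝 0) := by
    have h1 := h.comp (tendsto_add_atTop_nat 1)
    have h2 : Tendsto (fun N : ℕ => 1 / ((N + 1 : ℕ) : ℝ)) atTop (𝓝 0) := by
      simpa using tendsto_one_div_add_atTop_nhds_zero_nat (𝕜 := ℝ)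
    simpa using h1.add (h2.mul_const (2 * C))
  refine squeeze_zero (fun N => integral_nonneg fun i => abs_nonneg _) (fun N => ?_) hlim
  have hsi : Integrable (fun i => ∑ n ∈ Finset.range (N + 1),
      |∫ s, g (F (i, s)) ∂(η n) - ∫ s, g s ∂(η (n + 1))|) p :=
    integrable_finsetSum _ fun n _ => hmi (η n) _
  refine (integral_mono (hmi (cesaroMeasure η N) _)
    ((hsi.const_mul (1 / ((N + 1 : ℕ) : ℝ))).add
      (integrable_const ((1 / ((N + 1 : ℕ) : ℝ)) * (2 * C)))) (hpt N)).trans_eq ?_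
  rw [integral_add' (hsi.const_mul _) (integrable_const _), integral_const_mul,
    integral_finsetSum _ fun n _ => hmi (η n) _]
  simp

/-- A random map `F` of `X × P`, continuous in the compact fibers, that asymptotically takes `η n`
to `η (n + 1)` almost surely preserves any weak limit of the Cesàro averages of `η`. -/
theorem exists_ae_measurePreserving {F : Y × (X × P) → X × P} (hF : Measurable F)
    (hcont : ∀ i x, Continuous fun z => F (i, (x, z))) {η : ℕ → Measure (X × P)}
    (hη : ∀ n, IsProbabilityMeasure (η n)) (hfst : ∀ n, (η n).map Prod.fst = μ)
    (h : ∀ g : X × P → ℝ, Measurable g → ∀ C, (∀ s, |g s| ≤ C) →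
      Tendsto (fun N : ℕ => (1 / (N : ℝ)) * ∑ n ∈ Finset.range N,
        ∫ i, |∫ s, g (F (i, s)) ∂(η n) - ∫ s, g s ∂(η (n + 1))| ∂p) atTop (𝓝 0)) :
    ∃ ν : Measure (X × P), IsProbabilityMeasure ν ∧ ν.map Prod.fst = μ ∧
      ∀ᵐ i ∂p, MeasurePreserving (fun s => F (i, s)) ν ν := by
  have hprob := isProbabilityMeasure_cesaroMeasure hη
  have hmarg := map_cesaroMeasure measurable_fst hfst
  obtain ⟨ν, φ, hφ, hlim, hν⟩ := exists_subseq_tendsto_of_map_fst_eq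
    (fun N => (⟨cesaroMeasure η N, hprob N⟩ : ProbabilityMeasure (X × P))) hmarg
  have hFi : ∀ i, Measurable fun s => F (i, s) := fun i => hF.comp measurable_prodMk_left
  refine ⟨ν, inferInstance, hν, ?_⟩
  suffices hmap : ∀ᵐ i ∂p, (ν : Measure (X × P)).map (fun s => F (i, s)) = ν by
    filter_upwards [hmap] with i hi using ⟨hFi i, hi⟩
  refine ae_eq_of_forall_ae_integral_eq
    (ae_of_all _ fun i => Measure.isProbabilityMeasure_map (hFi i).aemeasurable)
    (ae_of_all _ fun i => inferInstance) fun g => ?_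
  have hg : Measurable g := g.continuous.measurable
  have hgC : ∀ s, |g s| ≤ ‖g‖ := g.norm_coe_le_norm
  have hbound : ∀ (ξ : Measure (X × P)) [IsProbabilityMeasure ξ] (g' : X × P → ℝ),
      (∀ s, |g' s| ≤ ‖g‖) → |∫ s, g' s ∂ξ| ≤ ‖g‖ := fun ξ _ g' hg' => by
    simpa using norm_integral_le_of_norm_le_const (μ := ξ) (f := g') (ae_of_all _ hg')
  have hm : ∀ (ξ : Measure (X × P)) [IsProbabilityMeasure ξ] (c : ℝ),
      StronglyMeasurable fun i => |∫ s, g (F (i, s)) ∂ξ - c| := fun ξ _ c => by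
    have hm' : StronglyMeasurable fun i => ∫ s, g (F (i, s)) ∂ξ :=
      (hg.comp hF).stronglyMeasurable.integral_prod_right'
    exact (hm'.sub stronglyMeasurable_const).norm
  have hle : ∀ (ξ : Measure (X × P)) [IsProbabilityMeasure ξ] (i : Y),
      |∫ s, g (F (i, s)) ∂ξ - ∫ s, g s ∂ξ| ≤ 2 * ‖g‖ := fun ξ _ i => by
    have h1 := hbound ξ (fun s => g (F (i, s))) fun s => hgC _
    have h2 := hbound ξ g hgC
    have h3 := abs_sub (∫ s, g (F (i, s)) ∂ξ) (∫ s, g s ∂ξ)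
    linarith
  have hzero := (tendsto_integral_abs_cesaroMeasure hF hη hg hgC
    (h g hg _ hgC)).comp hφ.tendsto_atTop
  have hconv := tendsto_integral_of_dominated_convergence (μ := p)
    (F := fun k i => |∫ s, g (F (i, s)) ∂(cesaroMeasure η (φ k)) -
      ∫ s, g s ∂(cesaroMeasure η (φ k))|)
    (f := fun i => |∫ s, g (F (i, s)) ∂(ν : Measure (X × P)) - ∫ s, g s ∂(ν : Measure (X × P))|)
    (fun _ => 2 * ‖g‖) (fun k => (hm _ _).aestronglyMeasurable) (integrable_const _)
    (fun k => ae_of_all _ fun i => by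
      rw [Real.norm_eq_abs, abs_abs]
      exact hle _ i)
    (ae_of_all _ fun i => by
      have h1 := tendsto_integral_of_continuous_snd hlim (fun k => hmarg (φ k)) hν
        (hg.comp (hFi i)) (fun s => hgC _) fun x => g.continuous.comp (hcont i x)
      have h2 := ProbabilityMeasure.tendsto_iff_forall_integral_tendsto.1 hlim g
      exact (h1.sub h2).abs)
  have hint0 := tendsto_nhds_unique hconv hzero
  rw [integral_eq_zero_iff_of_nonneg (fun i => abs_nonneg _)
    (Integrable.of_bound (hm _ _).aestronglyMeasurable (2 * ‖g‖)
      (ae_of_all _ fun i => by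
        rw [Real.norm_eq_abs, abs_abs]
        exact hle _ i))] at hint0
  filter_upwards [hint0] with i hi
  rw [integral_map (hFi i).aemeasurable g.continuous.aestronglyMeasurable]
  exact sub_eq_zero.1 (abs_eq_zero.1 hi)

end Cesaro

/-! ### The invariant measure -/

section Invariant

variable {X Y : Type*} [MeasurableSpace X] [MeasurableSpace Y] {p : Measure Y}
  [IsProbabilityMeasure p] {μ : Measure X} [IsProbabilityMeasure μ] {d : ℕ}
  {f : Y → X → X} {Afib : Y → X → Matrix.GeneralLinearGroup (Fin d) ℝ}

theorem map_fst_transportIter (hf : IsRandomTransformation p μ f)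
    (hA : MeasurableGL fun z : Y × X => Afib z.1 z.2) {Λ : Measure (X × ProjSpace d)}
    [IsProbabilityMeasure Λ] (hΛ : Λ.map Prod.fst = μ) (n : ℕ) :
    (transportIter p (fiberMaps f Afib) Λ n).map Prod.fst = μ := by
  have hF : Measurable (fiberMaps f Afib) := measurable_fiberMaps hf.measurable_uncurry hA
  induction n with
  | zero => exact hΛ
  | succ n ih =>
    have := isProbabilityMeasure_transportIter (p := p) (Λ := Λ) hF n
    have hcomp : Prod.fst ∘ fiberMaps f Afib =
        (fun q : Y × X => f q.1 q.2) ∘ Prod.map id Prod.fst := rfl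
    rw [transportIter, transport, Measure.map_map measurable_fst hF, hcomp,
      ← Measure.map_map hf.measurable_uncurry (measurable_id.prodMap measurable_fst),
      ← Measure.map_prod_map _ _ measurable_id measurable_fst, ih, Measure.map_id]
    exact (measurePreserving_snd.comp hf.measurePreserving_prodMk).map_eq

end Invariant

end RandomCocycle

theorem mainTheorem5 {X Y : Type*} [MeasurableSpace X] [StandardBorelSpace X]
    [MeasurableSpace Y] (μ : Measure X) [IsProbabilityMeasure μ]
    (p : Measure Y) [IsProbabilityMeasure p] (d : ℕ) (hd : 1 ≤ d)
    (f : Y → X → X)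
    (A : (ℤ → Y) × X → Matrix.GeneralLinearGroup (Fin d) ℝ)
    (Afib : Y → X → Matrix.GeneralLinearGroup (Fin d) ℝ)
    (hA : RandomCocycle.IsRandomCocycle p μ f A Afib)
    (hint : Integrable (fun z => Real.posLog (RandomCocycle.opNorm (A z)))
      (RandomCocycle.barMeasure p μ))
    (hint' : Integrable (fun z => Real.posLog (RandomCocycle.opNorm ((A z)⁻¹)))
      (RandomCocycle.barMeasure p μ))
    (hlam : RandomCocycle.lyapunovMin (RandomCocycle.barMeasure p μ)
        (RandomCocycle.skewShift f) A =
      RandomCocycle.lyapunovMax (RandomCocycle.barMeasure p μ)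
        (RandomCocycle.skewShift f) A) :
    ∃ η : Measure (X × RandomCocycle.ProjSpace d), IsProbabilityMeasure η ∧
      RandomCocycle.IsInvariantMeasure p μ f Afib η := by
  let := upgradeStandardBorel X
  have := RandomCocycle.isProbabilityMeasure_refMeasure hd
  have hf := hA.toIsRandomTransformation
  have hF : Measurable (RandomCocycle.fiberMaps f Afib) :=
    RandomCocycle.measurable_fiberMaps hf.measurable_uncurry hA.measurable_fib
  have hΛ : (μ.prod (RandomCocycle.refMeasure d)).map Prod.fst = μ := by
    rw [Measure.map_fst_prod, measure_univ, one_smul]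
  obtain ⟨η, hη, hfst, hinv⟩ := RandomCocycle.exists_ae_measurePreserving hF
    (fun i x => (continuous_const (y := f i x)).prodMk
      (RandomCocycle.continuous_smul_projSpace (Afib i x)))
    (fun n => RandomCocycle.isProbabilityMeasure_transportIter hF n)
    (RandomCocycle.map_fst_transportIter hf hA.measurable_fib hΛ)
    fun g hg C hC => RandomCocycle.tendsto_average_defect hd hA (hint.add hint') hlam hg hC
  exact ⟨η, hη, hfst, hinv⟩
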